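/- **Setting.** Let $d\in\{2,3\}$. Let $h_1,\dots,h_d>0$, $\widehat A=\mathrm{diag}(h_1,\dots,h_d)$, $A_{\widetilde T}=\widetilde A\widehat A$, $A_T\in O(d)$, $b_T\in\mathbb R^d$, where * $d=2$: $\widehat T$ is the triangle with vertices $\hat p_1=(0,0),\hat p_2=(1,0),\hat p_3=(0,1)$ and $\widetilde A=\begin{pmatrix}1&s\\0&t\end{pmatrix}$ with $s^2+t^2=1$, $t>0$; * $d=3$: $\widehat T$ is the tetrahedron with vertices $\hat p_1=(0,0,0)$, $\hat p_2=(1,0,0)$, $\hat p_3=(0,1,0)$ in type (i) and $\hat p_3=(1,1,0)$ in type (ii), $\hat p_4=(0,0,1)$, and $\widetilde A=\begin{pmatrix}1&\pm s_1&s_{21}\\0&t_1&s_{22}\\0&0&t_2\end{pmatrix}$ with sign $+$ in type (i) and $-$ in type (ii), where $s_1^2+t_1^2=1$, $s_1,t_1>0$, $h_2s_1\le h_1/2$, $s_{21}^2+s_{22}^2+t_2^2=1$, $t_2>0$, $h_3s_{21}\le h_1/2$. Put $\Phi_{\widetilde T}(\hat x)=A_{\widetilde T}\hat x$, $\Phi_T(\tilde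 x)=A_T\tilde x+b_T$, $\widetilde T=\Phi_{\widetilde T}(\widehat T)$, $T=\Phi_T(\widetilde T)$, $p_i=\Phi_T(\Phi_{\widetilde T}(\hat p_i))$. The vertices are assumed to be labelled as follows. If $d=2$, $p_2p_3$ is a longest edge of $T$ and $h_2\le h_1$. If $d=3$, a shortest edge $L_{\min}$ of $T$ is $p_1p_3$ in type (i) and $p_2p_3$ in type (ii); $p_1p_2$ is a longest one among the four edges sharing exactly one endpoint with $L_{\min}$; $|p_4-p_1|\le|p_4-p_2|$; and $|p_3-p_1|\le|p_3-p_2|$ in type (i), $|p_3-p_2|\le|p_3-p_1|$ in type (ii). Let $r_1=\frac{p_2-p_1}{|p_2-p_1|}$; for $d=2$ and for $d=3$, type (i), $r_2=\frac{p_3-p_1}{|p_3-p_1|}$; for type (ii), $r_2=\frac{p_3-p_2}{|p_3-p_2|}$; for $d=3$, $r_3=\frac{p_4-p_1}{|p_4-p_1|}$. Let $\partial_r^\varepsilon=\partial_{r_1}^{\varepsilon_1}\cdots\partial_{r_d}^{\varepsilon_d}$ with $\partial_{r_i}=r_i\cdot\nabla$. Let $\widetilde{\mathscr H}=(h_1,h_2t)$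 if $d=2$ and $\widetilde{\mathscr H}=(h_1,h_2t_1,h_3t_2)$ if $d=3$. For multi-indices write $h^\beta=\prod_ih_i^{\beta_i}$, $h^{-\beta}=1/h^\beta$, $\widetilde{\mathscr H}^\varepsilon=\prod_i\widetilde{\mathscr H}_i^{\varepsilon_i}$. Sobolev spaces on a closed simplex are those on its interior, derivatives are weak, $|v|_{W^{m,p}}=(\sum_{|\alpha|=m}\|\partial^\alpha v\|_{L^p}^p)^{1/p}$ (a maximum if $p=\infty$), $\|\cdot\|_2$ is the Euclidean operator norm, and $x^{\pm1/p}=1$ if $p=\infty$, $x>0$. **Statement.** Let $m,\ell\in\mathbb N_0$, $\ell\ge m$. There is a constant $c>0$ depending only on $d,m,\ell$ such that for all data as above, all $p\in[1,\infty]$ and all multi-indices $\beta,\gamma$ with $|\beta|=m$, $|\gamma|=\ell-m$, the following (1) and (2) hold. (1) For every $\hat\varphi\in W^{m,p}(\widehat T)$, the function $\tilde\varphi=\hat\varphi\circ\Phi_{\widetilde T}^{-1}$ belongs to $W^{m,p}(\widetilde T)$ and $$|\tilde\varphi|_{W^{m,p}(\widetilde T)}\le c\,|\det A_{\widetilde T}|^{1/p}\|\widetilde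 A^{-1}\|_2^m\Big(\sum_{|\beta|=m}(h^{-\beta})^p\|\partial^\beta_{\hat x}\hat\varphi\|_{L^p(\widehat T)}^p\Big)^{1/p}\quad(p<\infty),$$ $$|\tilde\varphi|_{W^{m,\infty}(\widetilde T)}\le c\,\|\widetilde A^{-1}\|_2^m\max_{|\beta|=m}\big(h^{-\beta}\|\partial^\beta_{\hat x}\hat\varphi\|_{L^\infty(\widehat T)}\big)\quad(p=\infty).$$ (2) For every $\hat\varphi\in W^{\ell,p}(\widehat T)$, with $\tilde\varphi=\hat\varphi\circ\Phi_{\widetilde T}^{-1}$ and $\varphi=\tilde\varphi\circ\Phi_T^{-1}$, one has $\varphi\in W^{\ell,p}(T)$, $\partial_r^\varepsilon\varphi$ exists and lies in $W^{m,p}(T)$ for $|\varepsilon|=\ell-m$, and $$\|\partial^\beta_{\hat x}\partial^\gamma_{\hat x}\hat\varphi\|_{L^p(\widehat T)}\le c\,|\det A_{\widetilde T}|^{-1/p}\|\widetilde A\|_2^m\,h^\beta\sum_{|\varepsilon|=|\gamma|}h^\varepsilon|\partial_r^\varepsilon\varphi|_{W^{m,p}(T)}.$$ (3) For every $M>0$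 there is a constant $c>0$ depending only on $d,m,\ell,M$ such that, for all data as above which, if $d=3$, satisfy in addition $|s_{22}|\le M\frac{h_2t_1}{h_3}$ (no additional condition if $d=2$), all $p\in[1,\infty]$, all $|\beta|=m$, $|\gamma|=\ell-m$ and every $\hat\varphi\in W^{\ell,p}(\widehat T)$, the function $\tilde\varphi=\hat\varphi\circ\Phi_{\widetilde T}^{-1}$ lies in $W^{\ell,p}(\widetilde T)$, $\partial^\varepsilon_{\tilde x}\tilde\varphi\in W^{m,p}(\widetilde T)$ for $|\varepsilon|=\ell-m$, and $$\|\partial^\beta_{\hat x}\partial^\gamma_{\hat x}\hat\varphi\|_{L^p(\widehat T)}\le c\,|\det A_{\widetilde T}|^{-1/p}\|\widetilde A\|_2^m\,h^\beta\sum_{|\varepsilon|=|\gamma|}\widetilde{\mathscr H}^\varepsilon|\partial^\varepsilon_{\tilde x}\tilde\varphi|_{W^{m,p}(\widetilde T)}.$$ -/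

import Mathlib

open MeasureTheory
open scoped ENNReal

noncomputable section

namespace AnisoFE

/-! ### Weak derivatives and Sobolev spaces on an open set -/

/-- The Euclidean space `ℝ^d`. -/
abbrev Pt (d : ℕ) := EuclideanSpace ℝ (Fin d)

/-- The multi-indices `α ∈ ℕ₀^d` with `|α| = n`. -/
abbrev multiIndices (d n : ℕ) : Finset (Fin d → ℕ) := Finset.Nat.antidiagonalTuple d n

/-- The power `x^α = x_1^{α_1} ⋯ x_d^{α_d}`. -/
def multiPow {d : ℕ} (x : Fin d → ℝ) (α : Fin d → ℕ) : ℝ := ∏ i, x i ^ α i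

/-- The standard basis of `ℝ^d`; derivatives along it are the partial derivatives. -/
def stdDir (d : ℕ) (i : Fin d) : Pt d := EuclideanSpace.single i 1

/-- The classical derivative `∂_{r_1}^{α_1} ⋯ ∂_{r_d}^{α_d} f` of a smooth function `f` along the
directions `r_1, …, r_d`, where `∂_{r_i} f (x) = r_i · ∇ f (x)`. -/
def dirDeriv {d : ℕ} (r : Fin d → Pt d) (α : Fin d → ℕ) (f : Pt d → ℝ) : Pt d → ℝ :=
  (List.finRange d).foldr (fun i g => (fun f' x => fderiv ℝ f' x (r i))^[α i] g) f

/-- Test functions on the open set `U`: smooth, with compact support contained in `U`. -/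
def IsTestFunction {d : ℕ} (U : Set (Pt d)) (f : Pt d → ℝ) : Prop :=
  ContDiff ℝ (⊤ : ℕ∞) f ∧ HasCompactSupport f ∧ tsupport f ⊆ U

/-- `g` is the weak derivative `∂_r^α u` of `u` on the open set `U`. For `r = stdDir d` this is the
usual weak partial derivative `∂^α u`. -/
def HasWeakDeriv {d : ℕ} (U : Set (Pt d)) (r : Fin d → Pt d) (α : Fin d → ℕ)
    (u g : Pt d → ℝ) : Prop :=
  LocallyIntegrableOn u U ∧ LocallyIntegrableOn g U ∧
    ∀ f : Pt d → ℝ, IsTestFunction U f →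
      ∫ x in U, u x * dirDeriv r α f x = (-1) ^ (∑ i, α i) * ∫ x in U, g x * f x

open Classical in
/-- The weak derivative `∂_r^α u` on `U` (unique up to null sets if it exists). -/
def weakDeriv {d : ℕ} (U : Set (Pt d)) (r : Fin d → Pt d) (α : Fin d → ℕ)
    (u : Pt d → ℝ) : Pt d → ℝ :=
  if h : ∃ g, HasWeakDeriv U r α u g then h.choose else 0

/-- Membership in the Sobolev space `W^{m,p}(U)`. -/
def MemSobolev {d : ℕ} (m : ℕ) (p : ℝ≥0∞) (U : Set (Pt d)) (u : Pt d → ℝ) : Prop :=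
  MemLp u p (volume.restrict U) ∧
    ∀ α : Fin d → ℕ, ∑ i, α i ≤ m →
      ∃ g, MemLp g p (volume.restrict U) ∧ HasWeakDeriv U (stdDir d) α u g

/-- The norm of `L^p(U)`. -/
def normLp {d : ℕ} (p : ℝ≥0∞) (U : Set (Pt d)) (u : Pt d → ℝ) : ℝ :=
  lpNorm u p (volume.restrict U)

/-- The seminorm `|u|_{W^{m,p}(U)}`: the `ℓ^p`-norm of the `L^p(U)`-norms of the weak partial
derivatives of order `m` (a maximum if `p = ∞`). -/
def sobolevSeminorm {d : ℕ} (m : ℕ) (p : ℝ≥0∞) (U : Set (Pt d)) (u : Pt d → ℝ) : ℝ :=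
  if p = ∞ then ⨆ α : multiIndices d m, normLp ∞ U (weakDeriv U (stdDir d) α u)
  else (∑ α ∈ multiIndices d m, normLp p U (weakDeriv U (stdDir d) α u) ^ p.toReal)
    ^ (1 / p.toReal)

/-! ### Simplices and the two-step affine mapping -/

/-- The linear map of a matrix on `ℝ^d`, with its Euclidean operator norm. -/
abbrev opr {d : ℕ} (A : Matrix (Fin d) (Fin d) ℝ) : Pt d →L[ℝ] Pt d :=
  Matrix.toEuclideanCLM (𝕜 := ℝ) A

/-- The parameters of a simplex `T = A_T (Ã Â T̂) + b_T` in dimension two, and in dimension three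
in the types (i) and (ii). The conditions on the parameters are collected in
`Element.IsStandard`. -/
inductive Element : ℕ → Type
  | tri (h₁ h₂ s t : ℝ) (AT : Matrix (Fin 2) (Fin 2) ℝ) (bT : Pt 2) : Element 2
  | tetI (h₁ h₂ h₃ s₁ t₁ s₂₁ s₂₂ t₂ : ℝ) (AT : Matrix (Fin 3) (Fin 3) ℝ) (bT : Pt 3) : Element 3
  | tetII (h₁ h₂ h₃ s₁ t₁ s₂₁ s₂₂ t₂ : ℝ) (AT : Matrix (Fin 3) (Fin 3) ℝ) (bT : Pt 3) : Element 3

namespace Element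

/-- The lengths `h_1, …, h_d`. -/
def h : {d : ℕ} → Element d → Fin d → ℝ
  | _, tri h₁ h₂ _ _ _ _ => ![h₁, h₂]
  | _, tetI h₁ h₂ h₃ _ _ _ _ _ _ _ => ![h₁, h₂, h₃]
  | _, tetII h₁ h₂ h₃ _ _ _ _ _ _ _ => ![h₁, h₂, h₃]

/-- The matrix `Ã`. -/
def matTilde : {d : ℕ} → Element d → Matrix (Fin d) (Fin d) ℝ
  | _, tri _ _ s t _ _ => !![1, s; 0, t]
  | _, tetI _ _ _ s₁ t₁ s₂₁ s₂₂ t₂ _ _ => !![1, s₁, s₂₁; 0, t₁, s₂₂; 0, 0, t₂]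
  | _, tetII _ _ _ s₁ t₁ s₂₁ s₂₂ t₂ _ _ => !![1, -s₁, s₂₁; 0, t₁, s₂₂; 0, 0, t₂]

/-- The matrix `A_T`. -/
def matT : {d : ℕ} → Element d → Matrix (Fin d) (Fin d) ℝ
  | _, tri _ _ _ _ AT _ => AT
  | _, tetI _ _ _ _ _ _ _ _ AT _ => AT
  | _, tetII _ _ _ _ _ _ _ _ AT _ => AT

/-- The vector `b_T`. -/
def vecT : {d : ℕ} → Element d → Pt d
  | _, tri _ _ _ _ _ bT => bT
  | _, tetI _ _ _ _ _ _ _ _ _ bT => bT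
  | _, tetII _ _ _ _ _ _ _ _ _ bT => bT

/-- The parameters `H̃_1, …, H̃_d`. -/
def H : {d : ℕ} → Element d → Fin d → ℝ
  | _, tri h₁ h₂ _ t _ _ => ![h₁, h₂ * t]
  | _, tetI h₁ h₂ h₃ _ t₁ _ _ t₂ _ _ => ![h₁, h₂ * t₁, h₃ * t₂]
  | _, tetII h₁ h₂ h₃ _ t₁ _ _ t₂ _ _ => ![h₁, h₂ * t₁, h₃ * t₂]

/-- The vertices `p̂_1, …, p̂_{d+1}` of the reference element. -/
def vertexHat : {d : ℕ} → Element d → Fin (d + 1) → Pt d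
  | _, tri _ _ _ _ _ _ => ![!₂[0, 0], !₂[1, 0], !₂[0, 1]]
  | _, tetI _ _ _ _ _ _ _ _ _ _ => ![!₂[0, 0, 0], !₂[1, 0, 0], !₂[0, 1, 0], !₂[0, 0, 1]]
  | _, tetII _ _ _ _ _ _ _ _ _ _ => ![!₂[0, 0, 0], !₂[1, 0, 0], !₂[1, 1, 0], !₂[0, 0, 1]]

variable {d : ℕ} (K : Element d)

/-- The matrix `A_{T̃} = Ã Â` with `Â = diag(h_1, …, h_d)`. -/
def matATilde : Matrix (Fin d) (Fin d) ℝ := K.matTilde * Matrix.diagonal K.h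

/-- The map `Φ_{T̃} : x̂ ↦ A_{T̃} x̂`. -/
def mapTilde (x : Pt d) : Pt d := opr K.matATilde x

/-- The map `Φ_T : x̃ ↦ A_T x̃ + b_T`. -/
def mapT (x : Pt d) : Pt d := opr K.matT x + K.vecT

/-- The inverse of `Φ_{T̃}`. -/
def mapTildeInv (x : Pt d) : Pt d := opr (K.matATilde)⁻¹ x

/-- The inverse of `Φ_T`. -/
def mapTInv (x : Pt d) : Pt d := opr (K.matT)⁻¹ (x - K.vecT)

/-- The vertices `p_1, …, p_{d+1}` of `T`. -/
def vertex (i : Fin (d + 1)) : Pt d := K.mapT (K.mapTilde (K.vertexHat i))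

/-- The closed reference simplex `T̂`. -/
def simplexHat : Set (Pt d) := convexHull ℝ (Set.range K.vertexHat)

/-- The closed simplex `T̃ = Φ_{T̃}(T̂)`. -/
def simplexTilde : Set (Pt d) := K.mapTilde '' K.simplexHat

/-- The closed simplex `T = Φ_T(T̃)`. -/
def simplexT : Set (Pt d) := K.mapT '' K.simplexTilde

/-- The conditions on the parameters and on the labelling of the vertices.
In dimension two `p_2 p_3` is the longest edge and `h_2 ≤ h_1`. In dimension three the shortest
edge `L_min` is `p_1 p_3` in type (i) and `p_2 p_3` in type (ii), and `p_1 p_2` is the longest of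
the four edges that share exactly one endpoint with `L_min`. The plane that bisects `p_1 p_2`
perpendicularly cuts space in two closed half-spaces, the points that are at least as close to
`p_1` as to `p_2` and vice versa; `p_4` lies on the side of `p_1`, and `p_3` lies on the side of
`p_1` in type (i) and of `p_2` in type (ii). -/
def IsStandard : {d : ℕ} → Element d → Prop
  | _, tri h₁ h₂ s t AT bT =>
      let p := (tri h₁ h₂ s t AT bT).vertex
      AT ∈ Matrix.orthogonalGroup (Fin 2) ℝ ∧
      0 < h₁ ∧ 0 < h₂ ∧ s ^ 2 + t ^ 2 = 1 ∧ 0 < t ∧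
      dist (p 0) (p 1) ≤ dist (p 1) (p 2) ∧ dist (p 0) (p 2) ≤ dist (p 1) (p 2) ∧ h₂ ≤ h₁
  | _, tetI h₁ h₂ h₃ s₁ t₁ s₂₁ s₂₂ t₂ AT bT =>
      let p := (tetI h₁ h₂ h₃ s₁ t₁ s₂₁ s₂₂ t₂ AT bT).vertex
      AT ∈ Matrix.orthogonalGroup (Fin 3) ℝ ∧
      (0 < h₁ ∧ 0 < h₂ ∧ 0 < h₃) ∧
      (s₁ ^ 2 + t₁ ^ 2 = 1 ∧ 0 < s₁ ∧ 0 < t₁ ∧ h₂ * s₁ ≤ h₁ / 2) ∧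
      (s₂₁ ^ 2 + s₂₂ ^ 2 + t₂ ^ 2 = 1 ∧ 0 < t₂ ∧ h₃ * s₂₁ ≤ h₁ / 2) ∧
      (∀ i j, i ≠ j → dist (p 0) (p 2) ≤ dist (p i) (p j)) ∧
      (dist (p 0) (p 3) ≤ dist (p 0) (p 1) ∧ dist (p 1) (p 2) ≤ dist (p 0) (p 1) ∧
        dist (p 2) (p 3) ≤ dist (p 0) (p 1)) ∧
      (dist (p 2) (p 0) ≤ dist (p 2) (p 1) ∧ dist (p 3) (p 0) ≤ dist (p 3) (p 1))
  | _, tetII h₁ h₂ h₃ s₁ t₁ s₂₁ s₂₂ t₂ AT bT =>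
      let p := (tetII h₁ h₂ h₃ s₁ t₁ s₂₁ s₂₂ t₂ AT bT).vertex
      AT ∈ Matrix.orthogonalGroup (Fin 3) ℝ ∧
      (0 < h₁ ∧ 0 < h₂ ∧ 0 < h₃) ∧
      (s₁ ^ 2 + t₁ ^ 2 = 1 ∧ 0 < s₁ ∧ 0 < t₁ ∧ h₂ * s₁ ≤ h₁ / 2) ∧
      (s₂₁ ^ 2 + s₂₂ ^ 2 + t₂ ^ 2 = 1 ∧ 0 < t₂ ∧ h₃ * s₂₁ ≤ h₁ / 2) ∧
      (∀ i j, i ≠ j → dist (p 1) (p 2) ≤ dist (p i) (p j)) ∧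
      (dist (p 1) (p 3) ≤ dist (p 0) (p 1) ∧ dist (p 0) (p 2) ≤ dist (p 0) (p 1) ∧
        dist (p 2) (p 3) ≤ dist (p 0) (p 1)) ∧
      (dist (p 2) (p 1) ≤ dist (p 2) (p 0) ∧ dist (p 3) (p 0) ≤ dist (p 3) (p 1))

/-- The additional geometric condition with constant `M`: nothing in dimension two, and
`|s₂₂| ≤ M h₂ t₁ / h₃` in dimension three. -/
def GeomCond (M : ℝ) : {d : ℕ} → Element d → Prop
  | _, tri _ _ _ _ _ _ => True
  | _, tetI _ h₂ h₃ _ t₁ _ s₂₂ _ _ _ => |s₂₂| ≤ M * (h₂ * t₁ / h₃)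
  | _, tetII _ h₂ h₃ _ t₁ _ s₂₂ _ _ _ => |s₂₂| ≤ M * (h₂ * t₁ / h₃)

/-- The unit edge vectors `r_1, …, r_d` of `T`. -/
def edgeDir : {d : ℕ} → Element d → Fin d → Pt d
  | _, tri h₁ h₂ s t AT bT =>
      let p := (tri h₁ h₂ s t AT bT).vertex
      ![(dist (p 1) (p 0))⁻¹ • (p 1 - p 0), (dist (p 2) (p 0))⁻¹ • (p 2 - p 0)]
  | _, tetI h₁ h₂ h₃ s₁ t₁ s₂₁ s₂₂ t₂ AT bT =>
      let p := (tetI h₁ h₂ h₃ s₁ t₁ s₂₁ s₂₂ t₂ AT bT).vertex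
      ![(dist (p 1) (p 0))⁻¹ • (p 1 - p 0), (dist (p 2) (p 0))⁻¹ • (p 2 - p 0),
        (dist (p 3) (p 0))⁻¹ • (p 3 - p 0)]
  | _, tetII h₁ h₂ h₃ s₁ t₁ s₂₁ s₂₂ t₂ AT bT =>
      let p := (tetII h₁ h₂ h₃ s₁ t₁ s₂₁ s₂₂ t₂ AT bT).vertex
      ![(dist (p 1) (p 0))⁻¹ • (p 1 - p 0), (dist (p 2) (p 1))⁻¹ • (p 2 - p 1),
        (dist (p 3) (p 0))⁻¹ • (p 3 - p 0)]

/-- The interior of `T̂`. -/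
def domHat : Set (Pt d) := interior K.simplexHat

/-- The interior of `T̃`. -/
def domTilde : Set (Pt d) := interior K.simplexTilde

/-- The interior of `T`. -/
def domT : Set (Pt d) := interior K.simplexT

/-- `φ̃ = φ̂ ∘ Φ_{T̃}⁻¹`. -/
def toTilde (u : Pt d → ℝ) : Pt d → ℝ := u ∘ K.mapTildeInv

/-- `φ = φ̃ ∘ Φ_T⁻¹`. -/
def toT (u : Pt d → ℝ) : Pt d → ℝ := K.toTilde u ∘ K.mapTInv

end Element

end AnisoFE

end

open AnisoFE MeasureTheory
open scoped ENNReal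

/-!
All three estimates are instances of the chain rule for an affine map `Φ x = A x + b`, where the
weights are read off from the entries of `A`.

A weak derivative of order `n` along vectors `w_i` is transported by `Φ` to the weak derivative
along the vectors `A w_i` (`HasListDeriv.comp_affineHomeo_symm`), and the `L^p`-norm is multiplied by
`|det A|^{1/p}` (`normLp_comp_affineHomeo_symm`). If `w_i = ∑_j a_{ij} v_j` with
`|a_{ij}| ≤ C_i b_j`, multilinear expansion bounds the derivative along the `w_i` by `d^n ∏ C_i`
times the sum of `b^α ‖∂_v^α u‖` over `|α| = n` (`HasListDeriv.exists_change_directions`). To make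
such expansions and concatenations possible, derivatives are indexed by lists of vectors instead of
multi-indices.

* In the first estimate a derivative on `T̃` along `e_i` is a derivative on `T̂` along
  `A_{T̃}⁻¹ e_i`, whose `j`-th component is at most `‖Ã⁻¹‖ h_j⁻¹`.
* In the second one, `A_T A_{T̃} e_i = h_i r_i`, so that `∂^γ` on `T̂` is exactly `h^γ ∂_r^γ` on `T`,
  and the components of `A_T A_{T̃} e_i` are at most `‖Ã‖ h_i` because `A_T` is orthogonal.
* In the third one, `∂^γ` is expanded on `T̃` with the bound `max 1 M * H̃_j` for the `j`-th component
  of `A_{T̃} e_i`. It uses `h_2 ≤ h_1` in dimension two, and `h_2 s_1 ≤ h_1 / 2`, `h_3 ≤ h_1` and the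
  geometric condition in dimension three.
-/

namespace AnisoFE

/-! ### Iterated derivatives along lists of vectors -/

section

variable {d : ℕ}

/-- The iterated directional derivative `∂_{v_1} ⋯ ∂_{v_n} f` along a list `v_1, …, v_n` of vectors.
Lists, unlike multi-indices with respect to a fixed frame, are stable under concatenation and under
linear maps. -/
noncomputable def listDeriv (L : List (Pt d)) (f : Pt d → ℝ) : Pt d → ℝ :=
  L.foldr (fun v g x => fderiv ℝ g x v) f

/-- The list `0, …, 0, 1, …, 1, …` in which `i` occurs `α i` times: the multi-index `α` written as a
list of indices. -/
def idxList (α : Fin d → ℕ) : List (Fin d) :=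
  (List.finRange d).flatMap fun i => List.replicate (α i) i

theorem length_idxList (α : Fin d → ℕ) : (idxList α).length = ∑ i, α i := by
  simp [idxList, List.length_flatMap, List.sum_ofFn, List.finRange, Function.comp_def]

theorem count_idxList (α : Fin d → ℕ) (i : Fin d) : (idxList α).count i = α i := by
  rw [idxList, List.count_flatMap]
  simp [List.finRange, List.sum_ofFn, List.count_replicate, Function.comp_def]

theorem prod_map_idxList (x : Fin d → ℝ) (α : Fin d → ℕ) :
    ((idxList α).map x).prod = multiPow x α := by
  simp [idxList, multiPow, List.finRange, List.flatMap_def, List.prod_flatten,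
    List.prod_ofFn]

theorem dirDeriv_eq_listDeriv (r : Fin d → Pt d) (α : Fin d → ℕ) (f : Pt d → ℝ) :
    dirDeriv r α f = listDeriv ((idxList α).map r) f := by
  rw [dirDeriv, listDeriv, idxList, List.map_flatMap, List.foldr_flatMap]
  congr 1
  funext i g
  rw [List.map_replicate]
  induction α i with
  | zero => rfl
  | succ n ih => rw [Function.iterate_succ_apply', ih, List.replicate_succ, List.foldr_cons]

theorem listDeriv_append (L₁ L₂ : List (Pt d)) (f : Pt d → ℝ) :
    listDeriv (L₁ ++ L₂) f = listDeriv L₁ (listDeriv L₂ f) := List.foldr_append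

theorem listDeriv_cons (v : Pt d) (L : List (Pt d)) (f : Pt d → ℝ) :
    listDeriv (v :: L) f = fun x => fderiv ℝ (listDeriv L f) x v := rfl

theorem contDiff_listDeriv (L : List (Pt d)) {f : Pt d → ℝ} (hf : ContDiff ℝ (⊤ : ℕ∞) f) :
    ContDiff ℝ (⊤ : ℕ∞) (listDeriv L f) := by
  induction L with
  | nil => exact hf
  | cons v L ih =>
    exact (ih.fderiv_right (m := (⊤ : ℕ∞)) (by simp)).clm_apply contDiff_const

/-- Partial derivatives of a smooth function commute. -/
theorem listDeriv_perm {L₁ L₂ : List (Pt d)} (h : L₁.Perm L₂) {f : Pt d → ℝ}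
    (hf : ContDiff ℝ (⊤ : ℕ∞) f) : listDeriv L₁ f = listDeriv L₂ f := by
  induction h with
  | nil => rfl
  | cons v _ ih => rw [listDeriv_cons, listDeriv_cons, ih]
  | swap v w L =>
    have hg := contDiff_listDeriv L hf
    set g := listDeriv L f
    have key : ∀ a b : Pt d, listDeriv (a :: b :: L) f =
        fun x => fderiv ℝ (fderiv ℝ g) x a b := by
      intro a b
      funext x
      have h1 : DifferentiableAt ℝ (fderiv ℝ g) x :=
        (hg.fderiv_right (m := (⊤ : ℕ∞)) (by simp)).differentiable (by simp) x
      change fderiv ℝ (fun y => fderiv ℝ g y b) x a = _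
      rw [fderiv_clm_apply h1 (differentiableAt_const _)]
      simp
    rw [key, key]
    funext x
    -- adjacent derivatives commute because second derivatives are symmetric
    exact (hg.contDiffAt.isSymmSndFDerivAt (by
      rw [minSmoothness_of_isRCLikeNormedField]
      exact WithTop.coe_le_coe.2 (le_top : (2 : ℕ∞) ≤ ⊤))) _ _
  | trans _ _ ih₁ ih₂ => rw [ih₁, ih₂]

theorem tsupport_listDeriv_subset (L : List (Pt d)) (f : Pt d → ℝ) :
    tsupport (listDeriv L f) ⊆ tsupport f := by
  induction L with
  | nil => exact subset_rfl
  | cons v L ih =>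
    refine subset_trans ?_ ih
    exact (closure_minimal (fun x hx => by
      refine support_fderiv_subset ℝ (f := listDeriv L f) ?_
      intro h0
      exact hx (by simp [listDeriv_cons, h0])) (isClosed_tsupport _))

theorem IsTestFunction.listDeriv {U : Set (Pt d)} {f : Pt d → ℝ} (hf : IsTestFunction U f)
    (L : List (Pt d)) : IsTestFunction U (listDeriv L f) :=
  ⟨contDiff_listDeriv L hf.1,
    hf.2.1.of_isClosed_subset (isClosed_tsupport _) (tsupport_listDeriv_subset L f),
    (tsupport_listDeriv_subset L f).trans hf.2.2⟩

/-- The chain rule along an affine map: derivatives in the directions `v` become derivatives in the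
directions `A v`. -/
theorem listDeriv_comp_affine (A : Pt d →L[ℝ] Pt d) (b : Pt d) (L : List (Pt d)) {f : Pt d → ℝ}
    (hf : ContDiff ℝ (⊤ : ℕ∞) f) :
    listDeriv L (fun x => f (A x + b)) = fun x => listDeriv (L.map A) f (A x + b) := by
  induction L with
  | nil => rfl
  | cons v L ih =>
    rw [listDeriv_cons, ih, List.map_cons, listDeriv_cons]
    funext x
    have h1 : HasFDerivAt (fun y => A y + b) A x := A.hasFDerivAt.add_const b
    have h2 := ((contDiff_listDeriv (L.map A) hf).differentiable (by simp) (A x + b)).hasFDerivAt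
    have h3 := (h2.comp x h1).fderiv
    simp only [Function.comp_def] at h3
    rw [h3]; rfl

theorem listDeriv_eq_iteratedFDeriv (L : List (Pt d)) {f : Pt d → ℝ}
    (hf : ContDiff ℝ (⊤ : ℕ∞) f) (x : Pt d) :
    listDeriv L f x = iteratedFDeriv ℝ L.length f x L.get := by
  induction L generalizing x with
  | nil => simp [listDeriv]
  | cons v L ih =>
    rw [listDeriv_cons]
    have h1 : DifferentiableAt ℝ (iteratedFDeriv ℝ L.length f) x :=
      hf.differentiable_iteratedFDeriv (by exact_mod_cast ENat.natCast_lt_top _) x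
    refine Eq.trans ?_
      (DifferentiableAt.iteratedFDeriv_succ_apply_left' h1 (m := (v :: L).get)).symm
    have : listDeriv L f = fun y => iteratedFDeriv ℝ L.length f y L.get := funext ih
    rw [this]
    rfl

/-- Multilinear expansion of an iterated derivative when every direction `w i` is a combination of
the vectors `v j`. The sum runs over all ways `J` of choosing one term for each factor. -/
theorem listDeriv_expand {ι : Type*} (I : List ι) (w : ι → Pt d) {κ : Type*} [Fintype κ]
    (v : κ → Pt d) (a : ι → κ → ℝ) (hw : ∀ i, w i = ∑ j, a i j • v j) {f : Pt d → ℝ}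
    (hf : ContDiff ℝ (⊤ : ℕ∞) f) (x : Pt d) :
    listDeriv (I.map w) f x = ∑ J : Fin I.length → κ,
      (∏ k, a (I.get k) (J k)) * listDeriv ((List.ofFn J).map v) f x := by
  classical
  -- a version with a free order `n`, which avoids rewriting inside the type `Fin L.length`
  have cast : ∀ (L : List (Pt d)) (n : ℕ) (h : n = L.length), listDeriv L f x =
      iteratedFDeriv ℝ n f x (fun k => L.get (k.cast h)) := by
    rintro L _ rfl
    exact listDeriv_eq_iteratedFDeriv L hf x
  rw [cast (I.map w) I.length (by simp)]
  have e1 : (fun k : Fin I.length => (I.map w).get (k.cast (by simp))) =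
      fun k => ∑ j, a (I.get k) j • v j := by
    funext k; simp [hw]
  rw [e1, ContinuousMultilinearMap.map_sum]
  refine Finset.sum_congr rfl fun J _ => ?_
  rw [ContinuousMultilinearMap.map_smul_univ, smul_eq_mul,
    cast ((List.ofFn J).map v) I.length (by simp)]
  congr 2
  funext k; simp

end

/-! ### Weak derivatives along lists of vectors -/

section

variable {d : ℕ}

/-- `g` is the weak derivative `∂_{v_1} ⋯ ∂_{v_n} u` on `U` along the list `L = [v_1, …, v_n]`. This
extends `HasWeakDeriv` to arbitrary sequences of directions, see `hasWeakDeriv_iff`. -/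
def HasListDeriv (U : Set (Pt d)) (L : List (Pt d)) (u g : Pt d → ℝ) : Prop :=
  LocallyIntegrableOn u U ∧ LocallyIntegrableOn g U ∧
    ∀ f : Pt d → ℝ, IsTestFunction U f →
      ∫ x in U, u x * listDeriv L f x = (-1) ^ L.length * ∫ x in U, g x * f x

theorem hasWeakDeriv_iff {U : Set (Pt d)} {r : Fin d → Pt d} {α : Fin d → ℕ} {u g : Pt d → ℝ} :
    HasWeakDeriv U r α u g ↔ HasListDeriv U ((idxList α).map r) u g := by
  simp only [HasWeakDeriv, HasListDeriv, dirDeriv_eq_listDeriv, List.length_map, length_idxList]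

theorem IsTestFunction.integrable_mul {U : Set (Pt d)} {u f : Pt d → ℝ}
    (hf : IsTestFunction U f) (hu : LocallyIntegrableOn u U) :
    Integrable (fun x => u x * f x) (volume.restrict U) := by
  have h1 : IntegrableOn u (tsupport f) := hu.integrableOn_compact_subset hf.2.2 hf.2.1
  have h2 : IntegrableOn (fun x => u x * f x) (tsupport f) :=
    h1.mul_continuousOn hf.1.continuous.continuousOn hf.2.1
  refine Integrable.restrict ((integrableOn_iff_integrable_of_support_subset ?_).1 h2)
  intro x hx
  exact subset_tsupport f fun h0 => hx (by simp [h0])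

theorem _root_.MeasureTheory.MemLp.locallyIntegrableOn_restrict {p : ℝ≥0∞} (hp : 1 ≤ p)
    {U : Set (Pt d)} {u : Pt d → ℝ} (hu : MemLp u p (volume.restrict U)) :
    LocallyIntegrableOn u U :=
  locallyIntegrableOn_of_locallyIntegrable_restrict (hu.locallyIntegrable hp)

namespace HasListDeriv

variable {U : Set (Pt d)} {L L₁ L₂ : List (Pt d)} {u g g' k : Pt d → ℝ}

theorem perm (h : HasListDeriv U L₁ u g) (hL : L₁.Perm L₂) : HasListDeriv U L₂ u g :=
  ⟨h.1, h.2.1, fun f hf => by rw [← listDeriv_perm hL hf.1, ← hL.length_eq]; exact h.2.2 f hf⟩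

/-- Weak derivatives are unique up to null sets, by the fundamental lemma of the calculus of
variations. -/
theorem ae_eq (hU : IsOpen U) (h : HasListDeriv U L u g) (h' : HasListDeriv U L u g') :
    g =ᵐ[volume.restrict U] g' := by
  have hz : ∀ᵐ x, x ∈ U → (g - g') x = 0 := by
    refine hU.ae_eq_zero_of_integral_contDiff_smul_eq_zero (h.2.1.sub h'.2.1) ?_
    intro f hf hc hs
    have ht : IsTestFunction U f := ⟨hf, hc, hs⟩
    have e : ∫ x in U, g x * f x = ∫ x in U, g' x * f x :=
      mul_left_cancel₀ (pow_ne_zero L.length (by norm_num : (-1 : ℝ) ≠ 0))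
        ((h.2.2 f ht).symm.trans (h'.2.2 f ht))
    -- the fundamental lemma tests on the whole space, but `f` vanishes outside `U`
    have e2 : ∫ x, f x • (g - g') x = ∫ x in U, f x • (g - g') x := by
      rw [setIntegral_eq_integral_of_forall_compl_eq_zero]
      intro x hx
      rw [image_eq_zero_of_notMem_tsupport fun hx' => hx (hs hx'), zero_smul]
    rw [e2]
    calc ∫ x in U, f x • (g - g') x = ∫ x in U, (g x * f x - g' x * f x) := by
          refine integral_congr_ae (.of_forall fun x => ?_)
          simp only [smul_eq_mul, Pi.sub_apply]; ring
      _ = 0 := by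
          rw [integral_sub (ht.integrable_mul h.2.1) (ht.integrable_mul h'.2.1), e, sub_self]
  rw [Filter.EventuallyEq, ae_restrict_iff' hU.measurableSet]
  filter_upwards [hz] with x hx hxU
  exact sub_eq_zero.1 (hx hxU)

theorem append (h₁ : HasListDeriv U L₁ u g) (h₂ : HasListDeriv U L₂ g k) :
    HasListDeriv U (L₁ ++ L₂) u k := by
  refine ⟨h₁.1, h₂.2.1, fun f hf => ?_⟩
  rw [listDeriv_append, h₁.2.2 _ (hf.listDeriv L₂), h₂.2.2 f hf, List.length_append, pow_add,
    mul_assoc]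

/-- If `∂_{L₁} u = g` and `∂_{L₁} ∂_{L₂} u = k` weakly, then `∂_{L₂} g = k`: the test functions
`∂_{L₂} f` are admissible in the definition of `g`. -/
theorem of_append (h : HasListDeriv U (L₁ ++ L₂) u k) (h₁ : HasListDeriv U L₁ u g) :
    HasListDeriv U L₂ g k := by
  refine ⟨h₁.2.1, h.2.1, fun f hf => ?_⟩
  have e := h.2.2 f hf
  rw [listDeriv_append, h₁.2.2 _ (hf.listDeriv L₂), List.length_append, pow_add, mul_assoc] at e
  exact mul_left_cancel₀ (pow_ne_zero L₁.length (by norm_num : (-1 : ℝ) ≠ 0)) e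

/-- A linear relation between derivatives of test functions carries over to weak derivatives. -/
theorem sum {ι : Type*} [Fintype ι] (c : ι → ℝ) (M : ι → List (Pt d)) (G : ι → Pt d → ℝ)
    (hu : LocallyIntegrableOn u U)
    (hG : ∀ i, HasListDeriv U (M i) u (G i)) (hlen : ∀ i, (M i).length = L.length)
    (hM : ∀ f : Pt d → ℝ, IsTestFunction U f → ∀ x,
      listDeriv L f x = ∑ i, c i * listDeriv (M i) f x) :
    HasListDeriv U L u (∑ i, c i • G i) := by
  refine ⟨hu, ?_, fun f hf => ?_⟩
  · classical
    refine Finset.sum_induction (fun i => c i • G i) (fun F => LocallyIntegrableOn F U)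
      (fun _ _ => LocallyIntegrableOn.add) ?_ ?_
    · exact (locallyIntegrable_zero).locallyIntegrableOn U
    · intro i _
      exact (hG i).2.1.smul (c i)
  · calc ∫ x in U, u x * listDeriv L f x
        = ∫ x in U, ∑ i, c i * (u x * listDeriv (M i) f x) := by
          refine integral_congr_ae (.of_forall fun x => ?_)
          simp only [hM f hf x, Finset.mul_sum]
          exact Finset.sum_congr rfl fun i _ => by ring
      _ = ∑ i, c i * ((-1) ^ L.length * ∫ x in U, G i x * f x) := by
          rw [integral_finsetSum _ fun i _ =>
            ((hf.listDeriv (M i)).integrable_mul hu).const_mul (c i)]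
          refine Finset.sum_congr rfl fun i _ => ?_
          rw [integral_const_mul, (hG i).2.2 f hf, hlen]
      _ = (-1) ^ L.length * ∫ x in U, ∑ i, c i * (G i x * f x) := by
          rw [integral_finsetSum _ fun i _ => (hf.integrable_mul (hG i).2.1).const_mul (c i),
            Finset.mul_sum]
          refine Finset.sum_congr rfl fun i _ => ?_
          rw [integral_const_mul]; ring
      _ = _ := by
          congr 1
          refine integral_congr_ae (.of_forall fun x => ?_)
          simp only [Finset.sum_apply, Pi.smul_apply, smul_eq_mul, Finset.sum_mul, mul_assoc]

end HasListDeriv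

theorem perm_idxList {I : List (Fin d)} : I.Perm (idxList fun i => I.count i) := by
  rw [List.perm_iff_count]
  intro i
  rw [count_idxList]

theorem count_mem_multiIndices (I : List (Fin d)) :
    (fun i => I.count i) ∈ multiIndices d I.length := by
  rw [Finset.Nat.mem_antidiagonalTuple, ← length_idxList]
  exact perm_idxList.length_eq.symm

/-- The weak derivative along directions `w i = ∑ j, a i j • v j` exists as soon as all weak
derivatives of that order along the `v j` do. If `|a i j| ≤ C i * b j`, its `L^p`-norm is controlled
by the norms of the latter, weighted with the powers `b^α`; this is how anisotropic weights enter
the estimates. All derivatives may be preceded by a fixed further derivative `∂_L`. -/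
theorem HasListDeriv.exists_change_directions {U : Set (Pt d)} {p : ℝ≥0∞} (hp : 1 ≤ p)
    {ι : Type*} (I : List ι) {w : ι → Pt d}
    {v : Fin d → Pt d} {a : ι → Fin d → ℝ} (hw : ∀ i, w i = ∑ j, a i j • v j) {C : ι → ℝ}
    {b : Fin d → ℝ} (ha : ∀ i j, |a i j| ≤ C i * b j) {L : List (Pt d)} {u : Pt d → ℝ}
    (hu : LocallyIntegrableOn u U)
    {g : (Fin d → ℕ) → Pt d → ℝ} (hg : ∀ α ∈ multiIndices d I.length,
      HasListDeriv U ((idxList α).map v ++ L) u (g α))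
    (hgp : ∀ α ∈ multiIndices d I.length, MemLp (g α) p (volume.restrict U)) (hb : ∀ j, 0 ≤ b j)
    (hC : ∀ i, 0 ≤ C i) :
    ∃ G, HasListDeriv U (I.map w ++ L) u G ∧ MemLp G p (volume.restrict U) ∧
      normLp p U G ≤ d ^ I.length * (I.map C).prod *
        ∑ α ∈ multiIndices d I.length, multiPow b α * normLp p U (g α) := by
  classical
  -- `cnt J` is the multi-index of the term `J` of the expansion
  let cnt : (Fin I.length → Fin d) → Fin d → ℕ := fun J i => (List.ofFn J).count i
  have hcnt : ∀ J, cnt J ∈ multiIndices d I.length := fun J => by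
    simpa using count_mem_multiIndices (List.ofFn J)
  have hmem : ∀ J : Fin I.length → Fin d,
      MemLp ((∏ k, a (I.get k) (J k)) • g (cnt J)) p (volume.restrict U) := fun J =>
    (hgp _ (hcnt J)).const_smul _
  refine ⟨∑ J : Fin I.length → Fin d, (∏ k, a (I.get k) (J k)) • g (cnt J), ?_, ?_, ?_⟩
  · refine HasListDeriv.sum _ (fun J => (List.ofFn J).map v ++ L) (fun J => g (cnt J)) hu
      (fun J => (hg _ (hcnt J)).perm ?_) (fun J => by simp) ?_
    · exact (perm_idxList.map v).symm.append_right L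
    · intro f hf x
      simp only [listDeriv_append]
      exact listDeriv_expand I w v a hw (contDiff_listDeriv L hf.1) x
  · exact memLp_finsetSum' _ fun J _ => hmem J
  · have hprodC : 0 ≤ (I.map C).prod := List.prod_nonneg fun x hx => by
      obtain ⟨i, _, rfl⟩ := List.mem_map.1 hx; exact hC i
    have hterm : ∀ α ∈ multiIndices d I.length, 0 ≤ multiPow b α * normLp p U (g α) :=
      fun α _ => mul_nonneg (Finset.prod_nonneg fun i _ => pow_nonneg (hb i) _) lpNorm_nonneg
    refine (lpNorm_sum_le (fun J _ => hmem J) hp).trans ?_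
    have hJ : ∀ J ∈ (Finset.univ : Finset (Fin I.length → Fin d)),
        lpNorm ((∏ k, a (I.get k) (J k)) • g (cnt J)) p (volume.restrict U) ≤
        (I.map C).prod * ∑ α ∈ multiIndices d I.length, multiPow b α * normLp p U (g α) := by
      intro J _
      rw [lpNorm_const_smul]
      have h1 : ‖∏ k, a (I.get k) (J k)‖ ≤ (I.map C).prod * multiPow b (cnt J) := by
        have h2 : ((List.ofFn J).map b).prod = multiPow b (cnt J) := by
          rw [← prod_map_idxList]
          exact (perm_idxList.map b).prod_eq
        have h3 : (I.map C).prod = ∏ k : Fin I.length, C (I.get k) := by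
          conv_lhs => rw [← List.ofFn_get I, List.map_ofFn, List.prod_ofFn]
          rfl
        rw [← h2, h3, List.map_ofFn, List.prod_ofFn, ← Finset.prod_mul_distrib, Real.norm_eq_abs,
          Finset.abs_prod]
        exact Finset.prod_le_prod (fun _ _ => abs_nonneg _) fun k _ => ha _ _
      calc _ ≤ ((I.map C).prod * multiPow b (cnt J)) * normLp p U (g (cnt J)) :=
            mul_le_mul_of_nonneg_right h1 lpNorm_nonneg
        _ = (I.map C).prod * (multiPow b (cnt J) * normLp p U (g (cnt J))) := by ring
        _ ≤ _ := mul_le_mul_of_nonneg_left (Finset.single_le_sum (f := fun α =>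
            multiPow b α * normLp p U (g α)) hterm (hcnt J)) hprodC
    refine (Finset.sum_le_card_nsmul _ _ _ hJ).trans (le_of_eq ?_)
    simp [Finset.card_univ, mul_assoc]

end

/-! ### Affine changes of variables -/

section

variable {d : ℕ}

/-- The affine homeomorphism `x ↦ A x + b`. -/
def affineHomeo (A : Pt d ≃L[ℝ] Pt d) (b : Pt d) : Pt d ≃ₜ Pt d :=
  A.toHomeomorph.trans (Homeomorph.addRight b)

variable (A : Pt d ≃L[ℝ] Pt d) (b : Pt d)

/-- The Jacobian factor `|det A|`. -/
noncomputable def jac (A : Pt d ≃L[ℝ] Pt d) : NNReal := Real.nnabs (A : Pt d →L[ℝ] Pt d).det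

theorem jac_ne_zero : jac A ≠ 0 := by
  have : (A : Pt d →L[ℝ] Pt d).det ≠ 0 := (LinearEquiv.isUnit_det' A.toLinearEquiv).ne_zero
  simpa [jac] using this

/-- The change of variables formula for Lebesgue measure under `x ↦ A x + b`. -/
theorem restrict_image_affineHomeo (U : Set (Pt d)) :
    volume.restrict (affineHomeo A b '' U) =
      jac A • (volume.restrict U).map (affineHomeo A b) := by
  have hdet : LinearMap.det (A : Pt d →ₗ[ℝ] Pt d) ≠ 0 :=
    (LinearEquiv.isUnit_det' A.toLinearEquiv).ne_zero
  have h1 : (volume : Measure (Pt d)).map (affineHomeo A b) = (jac A)⁻¹ • volume := by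
    have e : (affineHomeo A b : Pt d → Pt d) = (fun x => x + b) ∘ (A : Pt d →ₗ[ℝ] Pt d) := rfl
    rw [e, ← Measure.map_map (measurable_add_const b) (show Measurable (A : Pt d →ₗ[ℝ] Pt d) from
        A.continuous.measurable),
      Measure.map_linearMap_addHaar_eq_smul_addHaar volume hdet, Measure.map_smul,
      map_add_right_eq_self]
    have e2 : ENNReal.ofReal |(LinearMap.det (A : Pt d →ₗ[ℝ] Pt d))⁻¹| =
        (((jac A)⁻¹ : NNReal) : ℝ≥0∞) := by
      rw [ENNReal.ofReal, ENNReal.coe_inj, ← NNReal.coe_inj, Real.coe_toNNReal _ (abs_nonneg _)]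
      simp [jac, ContinuousLinearMap.det]
    rw [e2]; rfl
  have h2 : (volume : Measure (Pt d)) = jac A • volume.map (affineHomeo A b) := by
    rw [h1, smul_smul, mul_inv_cancel₀ (jac_ne_zero A), one_smul]
  conv_lhs => rw [h2]
  rw [Measure.restrict_smul, (affineHomeo A b).measurableEmbedding.restrict_map,
    (affineHomeo A b).injective.preimage_image]

theorem setIntegral_image_affineHomeo (U : Set (Pt d)) (F : Pt d → ℝ) :
    ∫ x in affineHomeo A b '' U, F x = jac A • ∫ x in U, F (affineHomeo A b x) := by
  rw [restrict_image_affineHomeo, integral_smul_nnreal_measure,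
    (affineHomeo A b).measurableEmbedding.integral_map]

variable {A b}

theorem IsTestFunction.comp_affineHomeo {U : Set (Pt d)} {f : Pt d → ℝ}
    (hf : IsTestFunction (affineHomeo A b '' U) f) :
    IsTestFunction U (fun x => f (affineHomeo A b x)) := by
  refine ⟨hf.1.comp (A.contDiff.add contDiff_const), hf.2.1.comp_homeomorph (affineHomeo A b), ?_⟩
  intro x hx
  have := hf.2.2 (tsupport_comp_subset_preimage f (affineHomeo A b).continuous hx)
  obtain ⟨y, hy, e⟩ := this
  exact (affineHomeo A b).injective e ▸ hy

theorem memLp_comp_affineHomeo_symm {U : Set (Pt d)} {p : ℝ≥0∞} {u : Pt d → ℝ}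
    (hu : MemLp u p (volume.restrict U)) :
    MemLp (u ∘ (affineHomeo A b).symm) p (volume.restrict (affineHomeo A b '' U)) := by
  rw [restrict_image_affineHomeo]
  refine MemLp.smul_measure ?_ ENNReal.coe_ne_top
  rw [(affineHomeo A b).measurableEmbedding.memLp_map_measure_iff]
  simpa [Function.comp_def] using hu

/-- Valid for `p = ∞` as well, where the exponent `(1 / p).toReal` is `0`. -/
theorem normLp_comp_affineHomeo_symm {U : Set (Pt d)} {p : ℝ≥0∞} (hp : 1 ≤ p) {u : Pt d → ℝ}
    (hu : MemLp u p (volume.restrict U)) :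
    normLp p (affineHomeo A b '' U) (u ∘ (affineHomeo A b).symm) =
      (jac A : ℝ) ^ (1 / p).toReal * normLp p U u := by
  have h := memLp_comp_affineHomeo_symm (A := A) (b := b) hu
  have hp0 : p ≠ 0 := (zero_lt_one.trans_le hp).ne'
  rw [normLp, normLp, ← toReal_eLpNorm h.1, ← toReal_eLpNorm hu.1, restrict_image_affineHomeo]
  change (eLpNorm _ p ((jac A : ℝ≥0∞) • _)).toReal = _
  rw [eLpNorm_smul_measure_of_ne_zero (by simpa using jac_ne_zero A),
    (affineHomeo A b).measurableEmbedding.eLpNorm_map_measure]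
  simp [Function.comp_def, ENNReal.toReal_mul, ← ENNReal.toReal_rpow]

theorem locallyIntegrableOn_comp_affineHomeo_symm {U : Set (Pt d)} {u : Pt d → ℝ}
    (hU : IsOpen U) (hu : LocallyIntegrableOn u U) :
    LocallyIntegrableOn (u ∘ (affineHomeo A b).symm) (affineHomeo A b '' U) := by
  have hV : IsOpen (affineHomeo A b '' U) := (affineHomeo A b).isOpenMap U hU
  rw [locallyIntegrableOn_iff hV.isLocallyClosed]
  rw [locallyIntegrableOn_iff hU.isLocallyClosed] at hu
  intro K hK hKc
  have e : affineHomeo A b '' ((affineHomeo A b).symm '' K) = K := by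
    simp [Set.image_image]
  have h1 := hu ((affineHomeo A b).symm '' K) (by
    rintro _ ⟨x, hx, rfl⟩
    obtain ⟨y, hy, rfl⟩ := hK hx
    simpa using hy) (hKc.image (affineHomeo A b).symm.continuous)
  have h2 := memLp_comp_affineHomeo_symm (A := A) (b := b) (memLp_one_iff_integrable.2 h1)
  rw [e] at h2
  exact memLp_one_iff_integrable.1 h2

/-- The chain rule for weak derivatives under the push-forward by `x ↦ A x + b`. -/
theorem HasListDeriv.comp_affineHomeo_symm {U : Set (Pt d)} {L : List (Pt d)} {u g : Pt d → ℝ}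
    (hU : IsOpen U) (h : HasListDeriv U L u g) :
    HasListDeriv (affineHomeo A b '' U) (L.map A) (u ∘ (affineHomeo A b).symm)
      (g ∘ (affineHomeo A b).symm) := by
  refine ⟨locallyIntegrableOn_comp_affineHomeo_symm hU h.1,
    locallyIntegrableOn_comp_affineHomeo_symm hU h.2.1, fun f hf => ?_⟩
  have e := h.2.2 _ hf.comp_affineHomeo
  have e2 : listDeriv L (fun x => f (affineHomeo A b x)) =
      fun x => listDeriv (L.map A) f (affineHomeo A b x) :=
    listDeriv_comp_affine (A : Pt d →L[ℝ] Pt d) b L hf.1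
  rw [e2] at e
  simp only [setIntegral_image_affineHomeo, Function.comp_apply, Homeomorph.symm_apply_apply, e,
    List.length_map]
  simp only [NNReal.smul_def, smul_eq_mul]
  ring

end

/-! ### Sobolev spaces and seminorms -/

section

variable {d : ℕ} {U : Set (Pt d)} {p : ℝ≥0∞} {u g : Pt d → ℝ}

theorem normLp_congr_ae {f f' : Pt d → ℝ} (hf : MemLp f p (volume.restrict U))
    (h : f =ᵐ[volume.restrict U] f') : normLp p U f' = normLp p U f := by
  rw [normLp, normLp, ← toReal_eLpNorm hf.1, ← toReal_eLpNorm (hf.1.congr h), eLpNorm_congr_ae h]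

theorem HasListDeriv.hasWeakDeriv_weakDeriv {r : Fin d → Pt d} {α : Fin d → ℕ}
    (h : HasListDeriv U ((idxList α).map r) u g) :
    HasListDeriv U ((idxList α).map r) u (weakDeriv U r α u) := by
  have hex : ∃ g, HasWeakDeriv U r α u g := ⟨g, hasWeakDeriv_iff.2 h⟩
  rw [weakDeriv, dif_pos hex]
  exact hasWeakDeriv_iff.1 hex.choose_spec

theorem HasListDeriv.weakDeriv_ae_eq {r : Fin d → Pt d} {α : Fin d → ℕ} (hU : IsOpen U)
    (h : HasListDeriv U ((idxList α).map r) u g) :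
    g =ᵐ[volume.restrict U] weakDeriv U r α u :=
  h.ae_eq hU h.hasWeakDeriv_weakDeriv

/-- A function in `W^{l,p}` has weak derivatives in `L^p` up to order `l` along arbitrary
directions, not only along the coordinate axes. -/
theorem MemSobolev.exists_hasListDeriv {l : ℕ} (hp : 1 ≤ p) (hu : MemSobolev l p U u)
    (L : List (Pt d)) (hL : L.length ≤ l) :
    ∃ G, HasListDeriv U L u G ∧ MemLp G p (volume.restrict U) := by
  have hex : ∀ α : Fin d → ℕ, ∃ g, α ∈ multiIndices d L.length →
      HasListDeriv U ((idxList α).map (stdDir d)) u g ∧ MemLp g p (volume.restrict U) := by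
    intro α
    by_cases hα : α ∈ multiIndices d L.length
    · obtain ⟨g, h1, h2⟩ := hu.2 α ((Finset.Nat.mem_antidiagonalTuple.1 hα).le.trans hL)
      exact ⟨g, fun _ => ⟨hasWeakDeriv_iff.1 h2, h1⟩⟩
    · exact ⟨0, fun h => absurd h hα⟩
  choose g hg using hex
  obtain ⟨G, h1, h2, -⟩ := HasListDeriv.exists_change_directions hp L (w := id) (v := stdDir d)
    (a := fun v j => v j) (C := fun v => ‖v‖) (b := fun _ => 1) (L := []) (u := u) (g := g)
    (fun v => by ext i; simp [stdDir, Finset.sum_apply, Pi.single_apply])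
    (fun v j => by simpa using PiLp.norm_apply_le v j) (hu.1.locallyIntegrableOn_restrict hp)
    (fun α hα => by simpa using (hg α hα).1) (fun α hα => (hg α hα).2) (fun _ => zero_le_one)
    (fun _ => norm_nonneg _)
  exact ⟨G, by simpa using h1, h2⟩

theorem MemSobolev.of_forall_list {m : ℕ} (hu : MemLp u p (volume.restrict U))
    (h : ∀ L : List (Pt d), L.length ≤ m →
      ∃ G, HasListDeriv U L u G ∧ MemLp G p (volume.restrict U)) : MemSobolev m p U u := by
  refine ⟨hu, fun α hα => ?_⟩
  obtain ⟨G, h1, h2⟩ := h ((idxList α).map (stdDir d)) (by simpa [length_idxList] using hα)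
  exact ⟨G, h2, hasWeakDeriv_iff.2 h1⟩

theorem MemSobolev.of_hasListDeriv {m l : ℕ} (hp : 1 ≤ p) (hu : MemSobolev l p U u)
    {L : List (Pt d)} (hL : L.length + m ≤ l) (h : HasListDeriv U L u g)
    (hg : MemLp g p (volume.restrict U)) : MemSobolev m p U g := by
  refine .of_forall_list hg fun L' hL' => ?_
  obtain ⟨G, h1, h2⟩ := hu.exists_hasListDeriv hp (L ++ L') (by simp; omega)
  exact ⟨G, h1.of_append h, h2⟩

/-- The chosen weak derivative `∂_r^ε u` of a function in `W^{l,p}` is a genuine one, and it belongs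
to `W^{m,p}` if `|ε| + m ≤ l`. -/
theorem MemSobolev.weakDeriv {m l : ℕ} (hp : 1 ≤ p) (hU : IsOpen U) (hu : MemSobolev l p U u)
    (r : Fin d → Pt d) {ε : Fin d → ℕ} (hε : ∑ i, ε i + m ≤ l) :
    HasListDeriv U ((idxList ε).map r) u (weakDeriv U r ε u) ∧
      MemSobolev m p U (weakDeriv U r ε u) := by
  have hlen : ((idxList ε).map r).length + m ≤ l := by simpa [length_idxList] using hε
  obtain ⟨G, h1, h2⟩ := hu.exists_hasListDeriv hp ((idxList ε).map r) (by omega)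
  have h3 := h1.hasWeakDeriv_weakDeriv
  exact ⟨h3, hu.of_hasListDeriv hp hlen h3 ((memLp_congr_ae (h1.weakDeriv_ae_eq hU)).1 h2)⟩

theorem MemSobolev.comp_affineHomeo_symm {m : ℕ} (hp : 1 ≤ p) (hU : IsOpen U)
    (hu : MemSobolev m p U u) (A : Pt d ≃L[ℝ] Pt d) (b : Pt d) :
    MemSobolev m p (affineHomeo A b '' U) (u ∘ (affineHomeo A b).symm) := by
  refine .of_forall_list (memLp_comp_affineHomeo_symm hu.1) fun L hL => ?_
  obtain ⟨G, h1, h2⟩ := hu.exists_hasListDeriv hp (L.map A.symm) (by simpa using hL)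
  refine ⟨_, ?_, memLp_comp_affineHomeo_symm h2⟩
  simpa [Function.comp_def] using h1.comp_affineHomeo_symm (A := A) (b := b) hU

theorem rpow_sum_le_card_mul {ι : Type*} (s : Finset ι) (y : ι → ℝ) (hy : ∀ i ∈ s, 0 ≤ y i)
    {Y : ℝ} (hY : 0 ≤ Y) (h : ∀ i ∈ s, y i ≤ Y) {q : ℝ} (hq : 1 ≤ q) :
    (∑ i ∈ s, y i ^ q) ^ (1 / q) ≤ s.card * Y := by
  have hq0 : 0 < q := by linarith
  rcases s.eq_empty_or_nonempty with rfl | hs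
  · simp [Real.zero_rpow (inv_ne_zero hq0.ne')]
  have hc : (1 : ℝ) ≤ s.card := by exact_mod_cast hs.card_pos
  have h1 : ∑ i ∈ s, y i ^ q ≤ s.card * Y ^ q := by
    simpa using Finset.sum_le_card_nsmul s _ _ fun i hi =>
      Real.rpow_le_rpow (hy i hi) (h i hi) hq0.le
  calc (∑ i ∈ s, y i ^ q) ^ (1 / q) ≤ (s.card * Y ^ q) ^ (1 / q) :=
        Real.rpow_le_rpow (Finset.sum_nonneg fun i hi => Real.rpow_nonneg (hy i hi) _) h1
          (by positivity)
    _ = (s.card : ℝ) ^ (1 / q) * Y := by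
        rw [Real.mul_rpow (by positivity) (by positivity), one_div, Real.rpow_rpow_inv hY hq0.ne']
    _ ≤ s.card * Y := by
        gcongr
        exact Real.rpow_le_self_of_one_le hc (by rw [div_le_one hq0]; exact hq)

theorem le_rpow_sum {ι : Type*} (s : Finset ι) (y : ι → ℝ) (hy : ∀ i ∈ s, 0 ≤ y i) {q : ℝ}
    (hq : 1 ≤ q) {i : ι} (hi : i ∈ s) : y i ≤ (∑ i ∈ s, y i ^ q) ^ (1 / q) := by
  have hq0 : 0 < q := by linarith
  calc y i = (y i ^ q) ^ (1 / q) := by rw [one_div, Real.rpow_rpow_inv (hy i hi) hq0.ne']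
    _ ≤ _ := Real.rpow_le_rpow (Real.rpow_nonneg (hy i hi) _)
        (Finset.single_le_sum (f := fun i => y i ^ q)
          (fun j hj => Real.rpow_nonneg (hy j hj) _) hi) (by positivity)

theorem one_le_toReal (hp : 1 ≤ p) (hp' : p ≠ ∞) : 1 ≤ p.toReal := by
  simpa using ENNReal.toReal_mono hp' hp

theorem sobolevSeminorm_nonneg (m : ℕ) : 0 ≤ sobolevSeminorm m p U u := by
  unfold sobolevSeminorm
  split_ifs
  · exact Real.iSup_nonneg fun _ => lpNorm_nonneg
  · exact Real.rpow_nonneg (Finset.sum_nonneg fun _ _ => Real.rpow_nonneg lpNorm_nonneg _) _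

theorem normLp_weakDeriv_le_sobolevSeminorm (hp : 1 ≤ p) {m : ℕ} {α : Fin d → ℕ}
    (hα : α ∈ multiIndices d m) :
    normLp p U (weakDeriv U (stdDir d) α u) ≤ sobolevSeminorm m p U u := by
  unfold sobolevSeminorm
  split_ifs with h
  · subst h
    exact le_ciSup
      (f := fun α : multiIndices d m => normLp ∞ U (AnisoFE.weakDeriv U (stdDir d) α u))
      (Set.finite_range _).bddAbove ⟨α, hα⟩
  · exact le_rpow_sum (multiIndices d m) (fun α => normLp p U (AnisoFE.weakDeriv U (stdDir d) α u))
      (fun _ _ => lpNorm_nonneg) (one_le_toReal hp h) hα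

theorem sobolevSeminorm_le (hp : 1 ≤ p) {m : ℕ} {Y : ℝ} (hY : 0 ≤ Y)
    (h : ∀ α ∈ multiIndices d m, normLp p U (weakDeriv U (stdDir d) α u) ≤ Y)
    (hne : (multiIndices d m).Nonempty) :
    sobolevSeminorm m p U u ≤ (multiIndices d m).card * Y := by
  unfold sobolevSeminorm
  split_ifs with h'
  · subst h'
    have hc : (1 : ℝ) ≤ (multiIndices d m).card := by exact_mod_cast hne.card_pos
    exact (Real.iSup_le (fun α : multiIndices d m => h α.1 α.2) hY).trans
      (le_mul_of_one_le_left hY hc)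
  · exact rpow_sum_le_card_mul _ _ (fun _ _ => lpNorm_nonneg) hY h (one_le_toReal hp h')

/-- A weak derivative of order `m` along vectors whose components are bounded by `C i` is bounded,
up to a factor that depends on `d` and `m`, by the product of these bounds times the seminorm of
`W^{m,p}`. -/
theorem HasListDeriv.normLp_le_sobolevSeminorm {m : ℕ} (hp : 1 ≤ p) (hU : IsOpen U)
    (hu : MemSobolev m p U u) {ι : Type*} (I : List ι) (hI : I.length = m) {w : ι → Pt d}
    {C : ι → ℝ} (hC : ∀ i j, |w i j| ≤ C i) (hC0 : ∀ i, 0 ≤ C i)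
    (hg : HasListDeriv U (I.map w) u g) :
    normLp p U g ≤
      d ^ m * (multiIndices d m).card * (I.map C).prod * sobolevSeminorm m p U u := by
  subst hI
  have hw : ∀ α ∈ multiIndices d I.length, HasListDeriv U ((idxList α).map (stdDir d)) u
      (AnisoFE.weakDeriv U (stdDir d) α u) ∧
      MemSobolev 0 p U (AnisoFE.weakDeriv U (stdDir d) α u) := fun α hα =>
    hu.weakDeriv hp hU (stdDir d) (Finset.Nat.mem_antidiagonalTuple.1 hα).le
  obtain ⟨G, h1, h2, h3⟩ := HasListDeriv.exists_change_directions hp I (w := w) (v := stdDir d)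
    (a := fun i j => w i j) (C := C) (b := fun _ => 1) (L := []) (u := u)
    (g := fun α => AnisoFE.weakDeriv U (stdDir d) α u)
    (fun v => by ext i; simp [stdDir, Finset.sum_apply, Pi.single_apply])
    (fun i j => by simpa using hC i j) (hu.1.locallyIntegrableOn_restrict hp)
    (fun α hα => by simpa using (hw α hα).1) (fun α hα => (hw α hα).2.1) (fun _ => zero_le_one) hC0
  have e : normLp p U g = normLp p U G :=
    normLp_congr_ae h2 (HasListDeriv.ae_eq hU (by simpa using h1) hg)
  have hprod : 0 ≤ (I.map C).prod := List.prod_nonneg fun x hx => by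
    obtain ⟨i, _, rfl⟩ := List.mem_map.1 hx; exact hC0 i
  have hsum : ∑ α ∈ multiIndices d I.length, multiPow (fun _ : Fin d => (1 : ℝ)) α *
      normLp p U (AnisoFE.weakDeriv U (stdDir d) α u) ≤
      (multiIndices d I.length).card * sobolevSeminorm I.length p U u := by
    simpa using Finset.sum_le_card_nsmul (multiIndices d I.length) _ _ fun α hα =>
      (by simpa [multiPow] using normLp_weakDeriv_le_sobolevSeminorm (u := u) (U := U) hp hα :
        multiPow (fun _ : Fin d => (1 : ℝ)) α * normLp p U (AnisoFE.weakDeriv U (stdDir d) α u) ≤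
          sobolevSeminorm I.length p U u)
  rw [e]
  refine h3.trans ((mul_le_mul_of_nonneg_left hsum (by positivity)).trans (le_of_eq ?_))
  ring

theorem multiIndices_nonempty (hd : 0 < d) (m : ℕ) : (multiIndices d m).Nonempty :=
  ⟨_, by simpa using count_mem_multiIndices (List.replicate m (⟨0, hd⟩ : Fin d))⟩

end

/-! ### Transfer estimates for affine maps -/

section

variable {d : ℕ} {U : Set (Pt d)} {p : ℝ≥0∞} {u g : Pt d → ℝ}

theorem listDeriv_smul {ι : Type*} (I : List ι) (c : ι → ℝ) (r : ι → Pt d) {f : Pt d → ℝ}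
    (hf : ContDiff ℝ (⊤ : ℕ∞) f) :
    listDeriv (I.map fun i => c i • r i) f =
      fun x => (I.map c).prod * listDeriv (I.map r) f x := by
  induction I with
  | nil => simp [listDeriv]
  | cons i I ih =>
    funext x
    have h1 : DifferentiableAt ℝ (listDeriv (I.map r) f) x :=
      (contDiff_listDeriv _ hf).differentiable (by simp) x
    simp only [List.map_cons, listDeriv_cons, ih, fderiv_const_mul h1, map_smul, List.prod_cons,
      smul_apply, smul_eq_mul]
    ring

/-- Rescaling of the directions in a weak derivative. -/
theorem HasListDeriv.inv_smul {ι : Type*} {I : List ι} {c : ι → ℝ} (hc : ∀ i, c i ≠ 0)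
    {r : ι → Pt d} {L : List (Pt d)}
    (h : HasListDeriv U ((I.map fun i => c i • r i) ++ L) u g) :
    HasListDeriv U (I.map r ++ L) u ((I.map c).prod⁻¹ • g) := by
  have hne : (I.map c).prod ≠ 0 := List.prod_ne_zero fun h0 => by
    obtain ⟨i, _, hi⟩ := List.mem_map.1 h0; exact hc i hi
  have := HasListDeriv.sum (L := I.map r ++ L) (fun _ : Unit => (I.map c).prod⁻¹)
    (fun _ => (I.map fun i => c i • r i) ++ L) (fun _ => g) h.1 (fun _ => h) (fun _ => by simp)
    (fun f hf x => by
      simp only [listDeriv_append, listDeriv_smul I c r (contDiff_listDeriv L hf.1),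
        Finset.univ_unique, Finset.sum_singleton]
      rw [← mul_assoc, inv_mul_cancel₀ hne, one_mul])
  simpa using this

theorem multiPow_nonneg {x : Fin d → ℝ} (hx : ∀ i, 0 ≤ x i) (α : Fin d → ℕ) : 0 ≤ multiPow x α :=
  Finset.prod_nonneg fun i _ => pow_nonneg (hx i) _

theorem multiPow_inv (x : Fin d → ℝ) (α : Fin d → ℕ) :
    multiPow (fun i => (x i)⁻¹) α = (multiPow x α)⁻¹ := by
  simp only [multiPow, inv_pow, Finset.prod_inv_distrib]

theorem prod_map_const_mul_idxList (κ : ℝ) (h : Fin d → ℝ) {m : ℕ} {β : Fin d → ℕ}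
    (hβ : β ∈ multiIndices d m) :
    ((idxList β).map fun i => κ * h i).prod = κ ^ m * multiPow h β := by
  rw [List.prod_map_mul, prod_map_idxList h, List.map_const', List.prod_replicate, length_idxList,
    Finset.Nat.mem_antidiagonalTuple.1 hβ]

theorem prod_map_const_idxList (κ : ℝ) {m : ℕ} {β : Fin d → ℕ} (hβ : β ∈ multiIndices d m) :
    ((idxList β).map fun _ => κ).prod = κ ^ m := by
  simp [length_idxList, Finset.Nat.mem_antidiagonalTuple.1 hβ]

theorem length_idxList_of_mem {m : ℕ} {β : Fin d → ℕ} (hβ : β ∈ multiIndices d m) :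
    (idxList β).length = m := by
  rw [length_idxList]; exact Finset.Nat.mem_antidiagonalTuple.1 hβ

theorem eq_sum_stdDir (x : Pt d) : x = ∑ j, x j • stdDir d j := by
  ext i; simp [stdDir, Finset.sum_apply, Pi.single_apply]

variable {A : Pt d ≃L[ℝ] Pt d} {b : Pt d} {h : Fin d → ℝ} {κ : ℝ} {m l : ℕ}

/-- Push-forward estimate. The entries of `A⁻¹` carry the weights `h_j⁻¹`, so every derivative
`∂^β` on `U` comes with the weight `h^{-β}`. -/
theorem sobolevSeminorm_comp_affineHomeo_symm_le (hd : 0 < d) (hp : 1 ≤ p) (hU : IsOpen U)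
    (hu : MemSobolev m p U u) (hh : ∀ i, 0 < h i) (hκ : 0 ≤ κ)
    (hA : ∀ i j, |(A.symm (stdDir d i)) j| ≤ κ * (h j)⁻¹) :
    sobolevSeminorm m p (affineHomeo A b '' U) (u ∘ (affineHomeo A b).symm) ≤
      (multiIndices d m).card * ((jac A : ℝ) ^ (1 / p).toReal * (d ^ m * κ ^ m *
        ∑ β ∈ multiIndices d m, (multiPow h β)⁻¹ * normLp p U (weakDeriv U (stdDir d) β u))) := by
  have hV : IsOpen (affineHomeo A b '' U) := (affineHomeo A b).isOpenMap U hU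
  have hinv : ∀ j, 0 ≤ (h j)⁻¹ := fun j => (inv_pos.2 (hh j)).le
  have hsum : 0 ≤ ∑ β ∈ multiIndices d m,
      (multiPow h β)⁻¹ * normLp p U (weakDeriv U (stdDir d) β u) :=
    Finset.sum_nonneg fun β _ => mul_nonneg
      (inv_nonneg.2 (multiPow_nonneg (fun i => (hh i).le) β)) lpNorm_nonneg
  refine sobolevSeminorm_le hp (by positivity) (fun α hα => ?_) (multiIndices_nonempty hd m)
  have hw : ∀ β ∈ multiIndices d (idxList α).length,
      HasListDeriv U ((idxList β).map (stdDir d)) u (weakDeriv U (stdDir d) β u) ∧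
      MemSobolev 0 p U (weakDeriv U (stdDir d) β u) := fun β hβ =>
    hu.weakDeriv hp hU (stdDir d) (by
      rw [length_idxList_of_mem hα] at hβ
      exact (Finset.Nat.mem_antidiagonalTuple.1 hβ).le)
  obtain ⟨G, h1, h2, h3⟩ := HasListDeriv.exists_change_directions hp (idxList α)
    (w := fun i => A.symm (stdDir d i)) (v := stdDir d)
    (a := fun i j => (A.symm (stdDir d i)) j) (C := fun _ => κ) (b := fun j => (h j)⁻¹)
    (L := []) (u := u) (g := fun β => weakDeriv U (stdDir d) β u) (fun i => eq_sum_stdDir _) hA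
    (hu.1.locallyIntegrableOn_restrict hp)
    (fun α hα => by simpa using (hw α hα).1) (fun α hα => (hw α hα).2.1) hinv (fun _ => hκ)
  have h4 : HasListDeriv (affineHomeo A b '' U) ((idxList α).map (stdDir d))
      (u ∘ (affineHomeo A b).symm) (G ∘ (affineHomeo A b).symm) := by
    simpa [Function.comp_def] using h1.comp_affineHomeo_symm (A := A) (b := b) hU
  rw [normLp_congr_ae (memLp_comp_affineHomeo_symm h2) (h4.weakDeriv_ae_eq hV),
    normLp_comp_affineHomeo_symm hp h2]
  rw [prod_map_const_idxList κ hα, length_idxList_of_mem hα] at h3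
  simp only [multiPow_inv] at h3
  exact mul_le_mul_of_nonneg_left h3 (by positivity)

theorem MemSobolev.hasListDeriv_weakDeriv_weakDeriv (hp : 1 ≤ p) (hU : IsOpen U) (hml : m ≤ l)
    (hu : MemSobolev l p U u) {β γ : Fin d → ℕ} (hβ : β ∈ multiIndices d m)
    (hγ : γ ∈ multiIndices d (l - m)) :
    HasListDeriv U ((idxList γ).map (stdDir d) ++ (idxList β).map (stdDir d)) u
      (AnisoFE.weakDeriv U (stdDir d) β (AnisoFE.weakDeriv U (stdDir d) γ u)) ∧
    MemLp (AnisoFE.weakDeriv U (stdDir d) β (AnisoFE.weakDeriv U (stdDir d) γ u)) p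
      (volume.restrict U) := by
  obtain ⟨h1, h2⟩ := hu.weakDeriv (m := m) hp hU (stdDir d) (ε := γ) (by
    rw [Finset.Nat.mem_antidiagonalTuple.1 hγ]; omega)
  obtain ⟨h3, h4⟩ := h2.weakDeriv (m := 0) hp hU (stdDir d) (ε := β) (by
    rw [Finset.Nat.mem_antidiagonalTuple.1 hβ]; omega)
  exact ⟨h1.append h3, h4.1⟩

theorem normLp_eq_jac_rpow_neg_mul (hp : 1 ≤ p) {f : Pt d → ℝ}
    (hf : MemLp f p (volume.restrict U)) :
    normLp p U f = (jac A : ℝ) ^ (-(1 / p).toReal) *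
      normLp p (affineHomeo A b '' U) (f ∘ (affineHomeo A b).symm) := by
  have hj : (0 : ℝ) < jac A := by exact_mod_cast pos_of_ne_zero (jac_ne_zero A)
  rw [normLp_comp_affineHomeo_symm hp hf, ← mul_assoc, ← Real.rpow_add hj, neg_add_cancel,
    Real.rpow_zero, one_mul]

/-- Pull-back estimate with edge derivatives. As `A e_i = h_i r_i`, the derivative `∂^γ` on `U` is
exactly `h^γ ∂_r^γ` on the image; only the remaining derivative `∂^β` has to be expanded. -/
theorem normLp_weakDeriv_le_edge (hp : 1 ≤ p) (hU : IsOpen U) (hml : m ≤ l)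
    (hu : MemSobolev l p U u) (hh : ∀ i, 0 < h i) (hκ : 0 ≤ κ)
    (hA : ∀ i j, |(A (stdDir d i)) j| ≤ κ * h i) {r : Fin d → Pt d}
    (hr : ∀ i, A (stdDir d i) = h i • r i) {β γ : Fin d → ℕ} (hβ : β ∈ multiIndices d m)
    (hγ : γ ∈ multiIndices d (l - m)) :
    normLp p U (weakDeriv U (stdDir d) β (weakDeriv U (stdDir d) γ u)) ≤
      d ^ m * (multiIndices d m).card * (jac A : ℝ) ^ (-(1 / p).toReal) * κ ^ m * multiPow h β *
        (multiPow h γ * sobolevSeminorm m p (affineHomeo A b '' U)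
          (weakDeriv (affineHomeo A b '' U) r γ (u ∘ (affineHomeo A b).symm))) := by
  have hV : IsOpen (affineHomeo A b '' U) := (affineHomeo A b).isOpenMap U hU
  obtain ⟨h1, h2⟩ := hu.hasListDeriv_weakDeriv_weakDeriv hp hU hml hβ hγ
  set f := weakDeriv U (stdDir d) β (weakDeriv U (stdDir d) γ u)
  obtain ⟨h3, h4⟩ := (hu.comp_affineHomeo_symm hp hU A b).weakDeriv (m := m) hp hV r (ε := γ) (by
    rw [Finset.Nat.mem_antidiagonalTuple.1 hγ]; omega)
  set ψ := weakDeriv (affineHomeo A b '' U) r γ (u ∘ (affineHomeo A b).symm)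
  have h5 := h1.comp_affineHomeo_symm (A := A) (b := b) hU
  have e : List.map (⇑A) (List.map (stdDir d) (idxList γ)) =
      (idxList γ).map fun i => h i • r i := by simp [Function.comp_def, hr]
  rw [List.map_append, e] at h5
  have h6 := (h5.inv_smul fun i => (hh i).ne').of_append h3
  rw [List.map_map] at h6
  have h7 := h6.normLp_le_sobolevSeminorm hp hV h4 (idxList β) (length_idxList_of_mem hβ)
    (C := fun i => κ * h i) hA (fun i => mul_nonneg hκ (hh i).le)
  rw [prod_map_const_mul_idxList κ h hβ, prod_map_idxList, normLp, lpNorm_const_smul, coe_nnnorm,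
    norm_inv, Real.norm_eq_abs, abs_of_nonneg (multiPow_nonneg (fun i => (hh i).le) γ)] at h7
  have hpos : 0 < multiPow h γ := Finset.prod_pos fun i _ => pow_pos (hh i) _
  -- `h7` bounds `(h^γ)⁻¹` times the transported function, which is a derivative of `∂_r^γ φ`
  rw [inv_mul_le_iff₀ hpos] at h7
  rw [normLp_eq_jac_rpow_neg_mul (A := A) (b := b) hp h2]
  refine (mul_le_mul_of_nonneg_left h7 (by positivity)).trans (le_of_eq ?_)
  ring

/-- Pull-back estimate with coordinate derivatives. The derivative `∂^β` is expanded with the bound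
`|A_{ji}| ≤ κ h_i`, which yields `κ^m h^β`, and the derivative `∂^γ` with the bound
`|A_{ji}| ≤ M H_j`, which yields the weights `H^ε`. -/
theorem normLp_weakDeriv_le_coord (hp : 1 ≤ p) (hU : IsOpen U) (hml : m ≤ l)
    (hu : MemSobolev l p U u) (hh : ∀ i, 0 < h i) (hκ : 0 ≤ κ)
    (hA : ∀ i j, |(A (stdDir d i)) j| ≤ κ * h i) {M : ℝ} (hM : 0 ≤ M) {H : Fin d → ℝ}
    (hH : ∀ i, 0 ≤ H i) (hAH : ∀ i j, |(A (stdDir d i)) j| ≤ M * H j) {β γ : Fin d → ℕ}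
    (hβ : β ∈ multiIndices d m) (hγ : γ ∈ multiIndices d (l - m)) :
    normLp p U (weakDeriv U (stdDir d) β (weakDeriv U (stdDir d) γ u)) ≤
      d ^ (l - m) * M ^ (l - m) * (d ^ m * (multiIndices d m).card) *
        (jac A : ℝ) ^ (-(1 / p).toReal) * κ ^ m * multiPow h β *
        ∑ ε ∈ multiIndices d (l - m), multiPow H ε * sobolevSeminorm m p (affineHomeo A b '' U)
          (weakDeriv (affineHomeo A b '' U) (stdDir d) ε (u ∘ (affineHomeo A b).symm)) := by
  have hV : IsOpen (affineHomeo A b '' U) := (affineHomeo A b).isOpenMap U hU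
  obtain ⟨h1, h2⟩ := hu.hasListDeriv_weakDeriv_weakDeriv hp hU hml hβ hγ
  set f := weakDeriv U (stdDir d) β (weakDeriv U (stdDir d) γ u)
  have hφ := hu.comp_affineHomeo_symm hp hU A b
  have h3 : ∀ ε ∈ multiIndices d (l - m), _ := fun ε hε =>
    hφ.weakDeriv (m := m) hp hV (stdDir d) (ε := ε) (by
      rw [Finset.Nat.mem_antidiagonalTuple.1 hε]; omega)
  set V := affineHomeo A b '' U
  set φ := u ∘ (affineHomeo A b).symm
  have hex : ∀ ε, ∃ G, ε ∈ multiIndices d (l - m) →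
      HasListDeriv V ((idxList β).map fun i => A (stdDir d i)) (weakDeriv V (stdDir d) ε φ) G ∧
        MemLp G p (volume.restrict V) := by
    intro ε
    by_cases hε : ε ∈ multiIndices d (l - m)
    · obtain ⟨G, hG⟩ := (h3 ε hε).2.exists_hasListDeriv hp
        ((idxList β).map fun i => A (stdDir d i)) (by
          rw [List.length_map, length_idxList_of_mem hβ])
      exact ⟨G, fun _ => hG⟩
    · exact ⟨0, fun h => absurd h hε⟩
  choose G hG using hex
  -- `G ε` is `∂^β`, transported to the image, of `∂^ε φ`
  have hGle : ∀ ε ∈ multiIndices d (l - m), normLp p V (G ε) ≤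
      d ^ m * (multiIndices d m).card * (κ ^ m * multiPow h β) *
        sobolevSeminorm m p V (weakDeriv V (stdDir d) ε φ) := by
    intro ε hε
    rw [← prod_map_const_mul_idxList κ h hβ]
    exact (hG ε hε).1.normLp_le_sobolevSeminorm hp hV (h3 ε hε).2 (idxList β)
      (length_idxList_of_mem hβ) hA (fun i => mul_nonneg hκ (hh i).le)
  have hlen := length_idxList_of_mem hγ
  obtain ⟨F, h4, h5, h6⟩ := HasListDeriv.exists_change_directions hp (idxList γ)
    (w := fun i => A (stdDir d i)) (v := stdDir d)
    (a := fun i j => (A (stdDir d i)) j) (C := fun _ => M) (b := H)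
    (L := (idxList β).map fun i => A (stdDir d i)) (u := φ) (g := G)
    (fun i => eq_sum_stdDir _) hAH (hφ.1.locallyIntegrableOn_restrict hp)
    (fun ε hε => by rw [hlen] at hε; exact (h3 ε hε).1.append (hG ε hε).1)
    (fun ε hε => by rw [hlen] at hε; exact (hG ε hε).2) hH (fun _ => hM)
  rw [prod_map_const_idxList M hγ, hlen] at h6
  have h7 : HasListDeriv V (((idxList γ).map fun i => A (stdDir d i)) ++
      (idxList β).map fun i => A (stdDir d i)) φ (f ∘ (affineHomeo A b).symm) := by
    simpa [Function.comp_def, V, φ] using h1.comp_affineHomeo_symm (A := A) (b := b) hU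
  rw [normLp_eq_jac_rpow_neg_mul (A := A) (b := b) hp h2, normLp_congr_ae h5 (h4.ae_eq hV h7)]
  have h8 : ∑ ε ∈ multiIndices d (l - m), multiPow H ε * normLp p V (G ε) ≤
      ∑ ε ∈ multiIndices d (l - m), multiPow H ε * (d ^ m * (multiIndices d m).card *
        (κ ^ m * multiPow h β) * sobolevSeminorm m p V (weakDeriv V (stdDir d) ε φ)) :=
    Finset.sum_le_sum fun ε hε =>
      mul_le_mul_of_nonneg_left (hGle ε hε) (multiPow_nonneg hH ε)
  refine (mul_le_mul_of_nonneg_left (h6.trans (mul_le_mul_of_nonneg_left h8 (by positivity)))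
    (by positivity)).trans (le_of_eq ?_)
  simp only [Finset.mul_sum]
  exact Finset.sum_congr rfl fun ε _ => by ring

end

/-! ### The affine maps of a standard element -/

section

variable {d : ℕ}

theorem opr_apply (M : Matrix (Fin d) (Fin d) ℝ) (x : Pt d) (i : Fin d) :
    opr M x i = ∑ j, M i j * x j := by
  rw [Matrix.ofLp_toEuclideanCLM]; rfl

theorem opr_stdDir (M : Matrix (Fin d) (Fin d) ℝ) (i j : Fin d) : opr M (stdDir d j) i = M i j := by
  simp [opr_apply, stdDir]

theorem opr_mul_apply (M N : Matrix (Fin d) (Fin d) ℝ) (x : Pt d) :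
    opr (M * N) x = opr M (opr N x) := by
  simp [opr]

theorem abs_entry_le_norm_opr (M : Matrix (Fin d) (Fin d) ℝ) (i j : Fin d) : |M i j| ≤ ‖opr M‖ := by
  rw [← opr_stdDir M i j]
  calc ‖opr M (stdDir d j) i‖ ≤ ‖opr M (stdDir d j)‖ := PiLp.norm_apply_le _ _
    _ ≤ ‖opr M‖ * ‖stdDir d j‖ := (opr M).le_opNorm _
    _ = ‖opr M‖ := by simp [stdDir]

theorem det_opr (M : Matrix (Fin d) (Fin d) ℝ) : (opr M).det = M.det := by
  rw [ContinuousLinearMap.det, Matrix.coe_toEuclideanCLM_eq_toEuclideanLin]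
  exact (congrArg (fun F => LinearMap.det (F M)) (Matrix.toLpLin_eq_toLin 2 2)).trans
    (LinearMap.det_toLin _ M)

theorem norm_opr_apply_of_mem_orthogonalGroup {M : Matrix (Fin d) (Fin d) ℝ}
    (hM : M ∈ Matrix.orthogonalGroup (Fin d) ℝ) (x : Pt d) : ‖opr M x‖ = ‖x‖ :=
  ContinuousLinearMap.norm_map_of_mem_unitary
    (Unitary.map_mem (Matrix.toEuclideanCLM (n := Fin d) (𝕜 := ℝ)) hM) x

/-- The continuous linear automorphism of `ℝ^d` given by an invertible matrix. -/
noncomputable def oprEquiv (M : Matrix (Fin d) (Fin d) ℝ) (hM : IsUnit M.det) : Pt d ≃L[ℝ] Pt d :=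
  ContinuousLinearEquiv.equivOfInverse (opr M) (opr M⁻¹)
    (fun x => by rw [← opr_mul_apply, Matrix.nonsing_inv_mul _ hM]; simp [opr])
    (fun x => by rw [← opr_mul_apply, Matrix.mul_nonsing_inv _ hM]; simp [opr])

theorem jac_oprEquiv (M : Matrix (Fin d) (Fin d) ℝ) (hM : IsUnit M.det) :
    (jac (oprEquiv M hM) : ℝ) = |M.det| := by
  rw [← det_opr]; rfl

namespace Element

variable {K : Element d}

theorem IsStandard.h_pos (hK : K.IsStandard) (i : Fin d) : 0 < K.h i := by
  cases K with
  | tri => obtain ⟨-, h1, h2, -⟩ := hK; fin_cases i <;> simpa [h]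
  | tetI => obtain ⟨-, ⟨h1, h2, h3⟩, -⟩ := hK; fin_cases i <;> simpa [h]
  | tetII => obtain ⟨-, ⟨h1, h2, h3⟩, -⟩ := hK; fin_cases i <;> simpa [h]

theorem IsStandard.H_nonneg (hK : K.IsStandard) (i : Fin d) : 0 ≤ K.H i := by
  cases K with
  | tri => obtain ⟨-, h1, h2, -, ht, -⟩ := hK; fin_cases i <;> simp [H] <;> positivity
  | tetI =>
    obtain ⟨-, ⟨h1, h2, h3⟩, ⟨-, -, ht, -⟩, ⟨-, ht2, -⟩, -⟩ := hK
    fin_cases i <;> simp [H] <;> positivity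
  | tetII =>
    obtain ⟨-, ⟨h1, h2, h3⟩, ⟨-, -, ht, -⟩, ⟨-, ht2, -⟩, -⟩ := hK
    fin_cases i <;> simp [H] <;> positivity

theorem IsStandard.matT_mem (hK : K.IsStandard) : K.matT ∈ Matrix.orthogonalGroup (Fin d) ℝ := by
  cases K <;> exact hK.1

theorem IsStandard.det_matTilde_pos (hK : K.IsStandard) : 0 < K.matTilde.det := by
  cases K with
  | tri => obtain ⟨-, h1, h2, -, ht, -⟩ := hK; simpa [matTilde, Matrix.det_fin_two]
  | tetI =>
    obtain ⟨-, -, ⟨-, -, ht, -⟩, ⟨-, ht2, -⟩, -⟩ := hK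
    simpa [matTilde, Matrix.det_fin_three] using mul_pos ht ht2
  | tetII =>
    obtain ⟨-, -, ⟨-, -, ht, -⟩, ⟨-, ht2, -⟩, -⟩ := hK
    simpa [matTilde, Matrix.det_fin_three] using mul_pos ht ht2

theorem IsStandard.isUnit_det (hK : K.IsStandard) : IsUnit K.matATilde.det := by
  rw [matATilde, Matrix.det_mul, Matrix.det_diagonal, isUnit_iff_ne_zero]
  exact mul_ne_zero hK.det_matTilde_pos.ne' (Finset.prod_ne_zero_iff.2 fun i _ => (hK.h_pos i).ne')

theorem IsStandard.abs_det_matT (hK : K.IsStandard) : |K.matT.det| = 1 := by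
  have h2 := congrArg Matrix.det ((Matrix.mem_orthogonalGroup_iff _ _).1 hK.matT_mem)
  rw [Matrix.det_mul, Matrix.det_one, Matrix.det_transpose] at h2
  rcases mul_self_eq_one_iff.1 h2 with h3 | h3 <;> simp [h3]

theorem IsStandard.isUnit_det_mul (hK : K.IsStandard) : IsUnit (K.matT * K.matATilde).det := by
  rw [Matrix.det_mul]
  refine IsUnit.mul (isUnit_iff_ne_zero.2 fun h0 => ?_) hK.isUnit_det
  have := hK.abs_det_matT
  simp [h0] at this

theorem matATilde_apply (K : Element d) (i j : Fin d) :
    K.matATilde i j = K.matTilde i j * K.h j := by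
  rw [matATilde, Matrix.mul_diagonal]

/-- `Φ_{T̃}` as an affine homeomorphism. -/
noncomputable def homeoTilde (hK : K.IsStandard) : Pt d ≃ₜ Pt d :=
  affineHomeo (oprEquiv K.matATilde hK.isUnit_det) 0

/-- `Φ_T ∘ Φ_{T̃}` as an affine homeomorphism. -/
noncomputable def homeoT (hK : K.IsStandard) : Pt d ≃ₜ Pt d :=
  affineHomeo (oprEquiv (K.matT * K.matATilde) hK.isUnit_det_mul) K.vecT

theorem coe_homeoTilde (hK : K.IsStandard) : ⇑(homeoTilde hK) = K.mapTilde :=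
  funext fun x => add_zero (opr K.matATilde x)

theorem coe_homeoT (hK : K.IsStandard) : ⇑(homeoT hK) = K.mapT ∘ K.mapTilde :=
  funext fun x => congrArg (· + K.vecT) (opr_mul_apply K.matT K.matATilde x)

theorem domTilde_eq (hK : K.IsStandard) : K.domTilde = homeoTilde hK '' K.domHat := by
  rw [domTilde, simplexTilde, ← coe_homeoTilde hK, domHat, Homeomorph.image_interior]

theorem domT_eq (hK : K.IsStandard) : K.domT = homeoT hK '' K.domHat := by
  rw [domT, simplexT, simplexTilde, ← Set.image_comp, ← coe_homeoT hK, domHat,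
    Homeomorph.image_interior]

theorem toTilde_eq (hK : K.IsStandard) (u : Pt d → ℝ) :
    K.toTilde u = u ∘ (homeoTilde hK).symm := by
  funext x
  change u (opr K.matATilde⁻¹ x) = u (opr K.matATilde⁻¹ (x + -0))
  simp

theorem toT_eq (hK : K.IsStandard) (u : Pt d → ℝ) : K.toT u = u ∘ (homeoT hK).symm := by
  funext x
  change u (opr K.matATilde⁻¹ (opr K.matT⁻¹ (x - K.vecT))) =
    u (opr (K.matT * K.matATilde)⁻¹ (x + -K.vecT))
  rw [Matrix.mul_inv_rev, opr_mul_apply, sub_eq_add_neg]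

/-- As `A_{T̃}⁻¹ = Â⁻¹ Ã⁻¹`, the `j`-th row of the inverse carries the factor `h_j⁻¹`. -/
theorem IsStandard.abs_inv_matATilde_le (hK : K.IsStandard) (i j : Fin d) :
    |K.matATilde⁻¹ j i| ≤ ‖opr (K.matTilde)⁻¹‖ * (K.h j)⁻¹ := by
  have e : K.matATilde⁻¹ = Matrix.diagonal (fun i => (K.h i)⁻¹) * K.matTilde⁻¹ := by
    refine Matrix.inv_eq_left_inv ?_
    rw [matATilde, Matrix.mul_assoc, ← Matrix.mul_assoc (K.matTilde⁻¹),
      Matrix.nonsing_inv_mul _ (isUnit_iff_ne_zero.2 hK.det_matTilde_pos.ne'), Matrix.one_mul,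
      Matrix.diagonal_mul_diagonal, ← Matrix.diagonal_one]
    congr 1
    funext i
    exact inv_mul_cancel₀ (hK.h_pos i).ne'
  have hpos := inv_pos.2 (hK.h_pos j)
  rw [e, Matrix.diagonal_mul, abs_mul, abs_of_pos hpos, mul_comm]
  exact mul_le_mul_of_nonneg_right (abs_entry_le_norm_opr _ _ _) hpos.le

theorem IsStandard.abs_matATilde_le (hK : K.IsStandard) (i j : Fin d) :
    |K.matATilde j i| ≤ ‖opr K.matTilde‖ * K.h i := by
  rw [matATilde_apply, abs_mul, abs_of_pos (hK.h_pos i)]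
  exact mul_le_mul_of_nonneg_right (abs_entry_le_norm_opr _ _ _) (hK.h_pos i).le

theorem IsStandard.abs_matT_mul_matATilde_le (hK : K.IsStandard) (i j : Fin d) :
    |(K.matT * K.matATilde) j i| ≤ ‖opr K.matTilde‖ * K.h i := by
  -- the orthogonal factor does not change the operator norm
  have hn : ‖opr (K.matT * K.matTilde)‖ ≤ ‖opr K.matTilde‖ := by
    refine ContinuousLinearMap.opNorm_le_bound _ (norm_nonneg _) fun x => ?_
    rw [opr_mul_apply, norm_opr_apply_of_mem_orthogonalGroup hK.matT_mem]
    exact (opr K.matTilde).le_opNorm x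
  rw [matATilde, ← Matrix.mul_assoc, Matrix.mul_diagonal, abs_mul, abs_of_pos (hK.h_pos i)]
  exact mul_le_mul_of_nonneg_right ((abs_entry_le_norm_opr _ _ _).trans hn) (hK.h_pos i).le

/-- The columns of `Ã` are unit vectors, so the image of `e_i` has length `h_i`. -/
theorem IsStandard.norm_opr_matT_mul_matATilde (hK : K.IsStandard) (i : Fin d) :
    ‖opr (K.matT * K.matATilde) (stdDir d i)‖ = K.h i := by
  have hcol : ∑ k, K.matTilde k i ^ 2 = 1 := by
    cases K with
    | tri =>
      obtain ⟨-, -, -, h1, -⟩ := hK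
      fin_cases i <;> simp [matTilde, Fin.sum_univ_two, h1]
    | tetI =>
      obtain ⟨-, -, ⟨h1, -⟩, ⟨h2, -⟩, -⟩ := hK
      fin_cases i <;> simp [matTilde, Fin.sum_univ_three, h1, h2]
    | tetII =>
      obtain ⟨-, -, ⟨h1, -⟩, ⟨h2, -⟩, -⟩ := hK
      fin_cases i <;> simp [matTilde, Fin.sum_univ_three, h1, h2]
  rw [opr_mul_apply, norm_opr_apply_of_mem_orthogonalGroup hK.matT_mem,
    EuclideanSpace.norm_eq, ← Real.sqrt_sq (hK.h_pos i).le]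
  congr 1
  simp only [opr_stdDir, matATilde_apply, Real.norm_eq_abs, sq_abs, mul_pow]
  rw [← Finset.sum_mul, hcol, one_mul]

theorem vertex_sub_vertex (K : Element d) (a c : Fin (d + 1)) :
    K.vertex a - K.vertex c = opr (K.matT * K.matATilde) (K.vertexHat a - K.vertexHat c) := by
  rw [opr_mul_apply, map_sub, map_sub]
  exact add_sub_add_right_eq_sub _ _ _

theorem IsStandard.dist_vertex (hK : K.IsStandard) {a c : Fin (d + 1)} {i : Fin d}
    (h : K.vertexHat a - K.vertexHat c = stdDir d i) : dist (K.vertex a) (K.vertex c) = K.h i := by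
  rw [dist_eq_norm, vertex_sub_vertex, h, hK.norm_opr_matT_mul_matATilde]

theorem IsStandard.smul_inv_dist (hK : K.IsStandard) {a c : Fin (d + 1)} {i : Fin d}
    (h : K.vertexHat a - K.vertexHat c = stdDir d i) :
    opr (K.matT * K.matATilde) (stdDir d i) =
      K.h i • ((dist (K.vertex a) (K.vertex c))⁻¹ • (K.vertex a - K.vertex c)) := by
  rw [hK.dist_vertex h, vertex_sub_vertex, h, smul_smul, mul_inv_cancel₀ (hK.h_pos i).ne', one_smul]

/-- In all three cases the edge of `T̂` that is mapped to the edge in direction `r_i` is parallel to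
`e_i`. In type (ii), this is the edge `p̂_2 p̂_3` for `i = 2`. -/
theorem IsStandard.opr_stdDir_eq_smul_edgeDir (hK : K.IsStandard) (i : Fin d) :
    opr (K.matT * K.matATilde) (stdDir d i) = K.h i • K.edgeDir i := by
  cases K with
  | tri =>
    fin_cases i
    · exact hK.smul_inv_dist (a := 1) (c := 0)
        (by ext k; fin_cases k <;> simp [vertexHat, stdDir])
    · exact hK.smul_inv_dist (a := 2) (c := 0)
        (by ext k; fin_cases k <;> simp [vertexHat, stdDir])
  | tetI =>
    fin_cases i
    · exact hK.smul_inv_dist (a := 1) (c := 0)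
        (by ext k; fin_cases k <;> simp [vertexHat, stdDir])
    · exact hK.smul_inv_dist (a := 2) (c := 0)
        (by ext k; fin_cases k <;> simp [vertexHat, stdDir])
    · exact hK.smul_inv_dist (a := 3) (c := 0)
        (by ext k; fin_cases k <;> simp [vertexHat, stdDir])
  | tetII =>
    fin_cases i
    · exact hK.smul_inv_dist (a := 1) (c := 0)
        (by ext k; fin_cases k <;> simp [vertexHat, stdDir])
    · exact hK.smul_inv_dist (a := 2) (c := 1)
        (by ext k; fin_cases k <;> simp [vertexHat, stdDir])
    · exact hK.smul_inv_dist (a := 3) (c := 0)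
        (by ext k; fin_cases k <;> simp [vertexHat, stdDir])

end Element

end

/-! ### Bounds by the parameters `H̃` -/

section

namespace Element

variable {d : ℕ} {K : Element d}

/-- `h_3 ≤ h_1`. This follows from the labelling of the vertices: `|p_4 - p_1| = h_3`, and the edges
at `p_4` in the relevant comparison are not longer than `|p_2 - p_1| = h_1`. -/
theorem IsStandard.h_two_le_h_zero {K : Element 3} (hK : K.IsStandard) : K.h 2 ≤ K.h 0 := by
  have h30 : dist (K.vertex 3) (K.vertex 0) = K.h 2 := hK.dist_vertex (by
    cases K <;> ext k <;> fin_cases k <;> simp [vertexHat, stdDir])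
  have h10 : dist (K.vertex 1) (K.vertex 0) = K.h 0 := hK.dist_vertex (by
    cases K <;> ext k <;> fin_cases k <;> simp [vertexHat, stdDir])
  rw [← h30, ← h10]
  cases K with
  | tetI =>
    obtain ⟨-, -, -, -, -, ⟨h1, -, -⟩, -, -⟩ := hK
    rw [dist_comm, dist_comm (vertex _ 1)]
    exact h1
  | tetII =>
    obtain ⟨-, -, -, -, -, ⟨h1, -, -⟩, -, h2⟩ := hK
    refine h2.trans ?_
    rw [dist_comm, dist_comm (vertex _ 1) (vertex _ 0)]
    exact h1

theorem abs_entry_tri_le {h₁ h₂ s t : ℝ} (h0 : 0 ≤ h₂) (h21 : h₂ ≤ h₁) (ht : 0 ≤ t)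
    (hst : s ^ 2 + t ^ 2 = 1) {c : ℝ} (hc : 1 ≤ c) (i j : Fin 2) :
    |(!![1, s; 0, t] : Matrix (Fin 2) (Fin 2) ℝ) j i| * ![h₁, h₂] i ≤ c * ![h₁, h₂ * t] j := by
  have hs : |s| ≤ 1 := by rw [← sq_le_one_iff_abs_le_one]; nlinarith [sq_nonneg t]
  have hone : ∀ y x : ℝ, 0 ≤ x → y ≤ x → y ≤ c * x := fun y x hx h =>
    h.trans (le_mul_of_one_le_left hx hc)
  have e : |s| * h₂ ≤ h₁ := by nlinarith
  have e2 : t * h₂ ≤ h₂ * t := (mul_comm _ _).le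
  have h1 : 0 ≤ h₁ := h0.trans h21
  have p2 := mul_nonneg h0 ht
  fin_cases i <;> fin_cases j
  · simpa using hone _ _ h1 le_rfl
  · simpa using hone _ _ p2 p2
  · simpa using hone _ _ h1 e
  · simpa [abs_of_nonneg ht] using hone _ _ p2 e2

/-- The condition on `s₂₂` is needed only for the entry in the second row and third column. -/
theorem abs_entry_tet_le {h₁ h₂ h₃ s₁ t₁ s₂₁ s₂₂ t₂ M : ℝ} (h2 : 0 ≤ h₂) (h3 : 0 < h₃)
    (h31 : h₃ ≤ h₁) (ht₁ : 0 ≤ t₁) (hs₁ : |s₁| * h₂ ≤ h₁) (ht₂ : 0 ≤ t₂)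
    (hsq : s₂₁ ^ 2 + s₂₂ ^ 2 + t₂ ^ 2 = 1) (hM : |s₂₂| ≤ M * (h₂ * t₁ / h₃)) (i j : Fin 3) :
    |(!![1, s₁, s₂₁; 0, t₁, s₂₂; 0, 0, t₂] : Matrix (Fin 3) (Fin 3) ℝ) j i| * ![h₁, h₂, h₃] i ≤
      max 1 M * ![h₁, h₂ * t₁, h₃ * t₂] j := by
  have hs : |s₂₁| ≤ 1 := by
    rw [← sq_le_one_iff_abs_le_one]; nlinarith [sq_nonneg s₂₂, sq_nonneg t₂]
  have hone : ∀ y x : ℝ, 0 ≤ x → y ≤ x → y ≤ max 1 M * x := fun y x hx h =>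
    h.trans (le_mul_of_one_le_left hx (le_max_left _ _))
  have h1 : 0 ≤ h₁ := h3.le.trans h31
  have p2 := mul_nonneg h2 ht₁
  have p3 := mul_nonneg h3.le ht₂
  have e02 : |s₂₁| * h₃ ≤ h₁ := by nlinarith
  have e12 : |s₂₂| * h₃ ≤ max 1 M * (h₂ * t₁) := by
    have := mul_le_mul_of_nonneg_right hM h3.le
    rw [mul_assoc, div_mul_cancel₀ _ h3.ne'] at this
    exact this.trans (mul_le_mul_of_nonneg_right (le_max_right _ _) p2)
  fin_cases i <;> fin_cases j
  · simpa using hone _ _ h1 le_rfl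
  · simpa using hone _ _ p2 p2
  · simpa using hone _ _ p3 p3
  · simpa using hone _ _ h1 hs₁
  · simpa [abs_of_nonneg ht₁] using hone _ _ p2 (mul_comm t₁ h₂).le
  · simpa using hone _ _ p3 p3
  · simpa using hone _ _ h1 e02
  · simpa using e12
  · simpa [abs_of_nonneg ht₂] using hone _ _ p3 (mul_comm t₂ h₃).le

/-- The rows of `A_{T̃}` are controlled by the parameters `H̃_j`. -/
theorem IsStandard.abs_matATilde_le_H (hK : K.IsStandard) {M : ℝ} (hM : K.GeomCond M)
    (i j : Fin d) : |K.matATilde j i| ≤ max 1 M * K.H j := by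
  rw [matATilde_apply, abs_mul, abs_of_pos (hK.h_pos i)]
  cases K with
  | tri =>
    obtain ⟨-, -, h2, hst, ht, -, -, h21⟩ := hK
    exact abs_entry_tri_le h2.le h21 ht.le hst (le_max_left _ _) i j
  | tetI h₁ h₂ h₃ s₁ =>
    have h31 := hK.h_two_le_h_zero
    obtain ⟨-, ⟨h1, h2, h3⟩, ⟨-, hs1, ht1, hs⟩, ⟨hsq, ht2, -⟩, -⟩ := hK
    have e : s₁ * h₂ ≤ h₁ := by linarith
    exact abs_entry_tet_le h2.le h3 h31 ht1.le (by rw [abs_of_pos hs1]; exact e) ht2.le hsq hM i j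
  | tetII h₁ h₂ h₃ s₁ =>
    have h31 := hK.h_two_le_h_zero
    obtain ⟨-, ⟨h1, h2, h3⟩, ⟨-, hs1, ht1, hs⟩, ⟨hsq, ht2, -⟩, -⟩ := hK
    have e : s₁ * h₂ ≤ h₁ := by linarith
    exact abs_entry_tet_le h2.le h3 h31 ht1.le (by rw [abs_neg, abs_of_pos hs1]; exact e) ht2.le
      hsq hM i j

end Element

end

/-! ### The transfer estimates for standard elements -/

section

theorem isOpen_domHat {d : ℕ} (K : Element d) : IsOpen K.domHat := isOpen_interior

theorem inv_multiPow_rpow_mul_rpow {d : ℕ} {K : Element d} (hK : K.IsStandard) (β : Fin d → ℕ)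
    {x : ℝ} (hx : 0 ≤ x) (q : ℝ) :
    ((multiPow K.h β)⁻¹) ^ q * x ^ q = ((multiPow K.h β)⁻¹ * x) ^ q :=
  (Real.mul_rpow (inv_nonneg.2 (multiPow_nonneg (fun i => (hK.h_pos i).le) β)) hx).symm

/-- The first transfer estimate, for all `p` at once: `S` stands for the weighted `ℓ^p`-sum or the
maximum on the right-hand side, of which only that it dominates each term is used. -/
theorem sobolevSeminorm_toTilde_le {d : ℕ} (hd : 0 < d) {K : Element d} (hK : K.IsStandard) {m : ℕ}
    {p : ℝ≥0∞} (hp : 1 ≤ p) {u : Pt d → ℝ} (hu : MemSobolev m p K.domHat u) {S : ℝ}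
    (hS : ∀ β ∈ multiIndices d m,
      (multiPow K.h β)⁻¹ * normLp p K.domHat (weakDeriv K.domHat (stdDir d) β u) ≤ S) :
    sobolevSeminorm m p K.domTilde (K.toTilde u) ≤
      ((multiIndices d m).card ^ 2 * d ^ m) * |K.matATilde.det| ^ (1 / p).toReal *
        ‖opr (K.matTilde)⁻¹‖ ^ m * S := by
  have h1 := sobolevSeminorm_comp_affineHomeo_symm_le
    (A := oprEquiv K.matATilde hK.isUnit_det) (b := 0) (κ := ‖opr (K.matTilde)⁻¹‖) hd hp
    (isOpen_domHat K) hu hK.h_pos (norm_nonneg _) (fun i j => by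
      change |opr K.matATilde⁻¹ (stdDir d i) j| ≤ _
      rw [opr_stdDir]
      exact hK.abs_inv_matATilde_le i j)
  rw [jac_oprEquiv] at h1
  rw [Element.domTilde_eq hK, Element.toTilde_eq hK]
  refine h1.trans ?_
  have h2 : ∑ β ∈ multiIndices d m, (multiPow K.h β)⁻¹ *
      normLp p K.domHat (weakDeriv K.domHat (stdDir d) β u) ≤ (multiIndices d m).card * S := by
    simpa using Finset.sum_le_card_nsmul _ _ _ hS
  calc _ ≤ ((multiIndices d m).card : ℝ) * (|K.matATilde.det| ^ (1 / p).toReal *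
        (d ^ m * ‖opr (K.matTilde)⁻¹‖ ^ m * ((multiIndices d m).card * S))) := by gcongr
    _ = _ := by ring

end

end AnisoFE

theorem mainTheorem6 (d : ℕ) (hd : d = 2 ∨ d = 3) (m l : ℕ) (hml : m ≤ l) :
    (∃ c : ℝ, 0 < c ∧ ∀ K : Element d, K.IsStandard →
      -- transfer from the reference element to `T̃`
      (∀ p : ℝ≥0∞, 1 ≤ p → ∀ u : Pt d → ℝ, MemSobolev m p K.domHat u →
        MemSobolev m p K.domTilde (K.toTilde u) ∧
        (p ≠ ∞ →
          sobolevSeminorm m p K.domTilde (K.toTilde u) ≤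
            c * |K.matATilde.det| ^ (1 / p.toReal) * ‖opr (K.matTilde)⁻¹‖ ^ m *
              (∑ β ∈ multiIndices d m, ((multiPow K.h β)⁻¹) ^ p.toReal *
                normLp p K.domHat (weakDeriv K.domHat (stdDir d) β u) ^ p.toReal)
                  ^ (1 / p.toReal)) ∧
        (p = ∞ →
          sobolevSeminorm m ∞ K.domTilde (K.toTilde u) ≤
            c * ‖opr (K.matTilde)⁻¹‖ ^ m *
              ⨆ β : multiIndices d m, (multiPow K.h β)⁻¹ *
                normLp ∞ K.domHat (weakDeriv K.domHat (stdDir d) β u))) ∧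
      -- transfer from `T` to the reference element, with derivatives along the edges of `T`
      (∀ p : ℝ≥0∞, 1 ≤ p → ∀ u : Pt d → ℝ, MemSobolev l p K.domHat u →
        MemSobolev l p K.domT (K.toT u) ∧
        (∀ ε ∈ multiIndices d (l - m),
          (∃ g, HasWeakDeriv K.domT K.edgeDir ε (K.toT u) g) ∧
          MemSobolev m p K.domT (weakDeriv K.domT K.edgeDir ε (K.toT u))) ∧
        ∀ β ∈ multiIndices d m, ∀ γ ∈ multiIndices d (l - m),
          normLp p K.domHat
              (weakDeriv K.domHat (stdDir d) β (weakDeriv K.domHat (stdDir d) γ u)) ≤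
            c * |K.matATilde.det| ^ (-(1 / p).toReal) * ‖opr K.matTilde‖ ^ m * multiPow K.h β *
              ∑ ε ∈ multiIndices d (l - m), multiPow K.h ε *
                sobolevSeminorm m p K.domT (weakDeriv K.domT K.edgeDir ε (K.toT u)))) ∧
    -- transfer from `T̃` to the reference element under the additional geometric condition
    (∀ M : ℝ, 0 < M → ∃ c : ℝ, 0 < c ∧
      ∀ K : Element d, K.IsStandard → K.GeomCond M →
      ∀ p : ℝ≥0∞, 1 ≤ p → ∀ u : Pt d → ℝ, MemSobolev l p K.domHat u →
        MemSobolev l p K.domTilde (K.toTilde u) ∧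
        (∀ ε ∈ multiIndices d (l - m),
          MemSobolev m p K.domTilde (weakDeriv K.domTilde (stdDir d) ε (K.toTilde u))) ∧
        ∀ β ∈ multiIndices d m, ∀ γ ∈ multiIndices d (l - m),
          normLp p K.domHat
              (weakDeriv K.domHat (stdDir d) β (weakDeriv K.domHat (stdDir d) γ u)) ≤
            c * |K.matATilde.det| ^ (-(1 / p).toReal) * ‖opr K.matTilde‖ ^ m * multiPow K.h β *
              ∑ ε ∈ multiIndices d (l - m), multiPow K.H ε *
                sobolevSeminorm m p K.domTilde
                  (weakDeriv K.domTilde (stdDir d) ε (K.toTilde u))) := by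
  have hd0 : 0 < d := by omega
  have hd0' : (0 : ℝ) < d := by exact_mod_cast hd0
  set N : ℝ := ((multiIndices d m).card : ℝ) with hNdef
  have hN : 1 ≤ N := by
    rw [hNdef]
    exact_mod_cast (multiIndices_nonempty hd0 m).card_pos
  have hjac : ∀ K : Element d, ∀ hK : K.IsStandard,
      (jac (oprEquiv (K.matT * K.matATilde) hK.isUnit_det_mul) : ℝ) = |K.matATilde.det| := by
    intro K hK
    rw [jac_oprEquiv, Matrix.det_mul, abs_mul, hK.abs_det_matT, one_mul]
  refine ⟨⟨N ^ 2 * d ^ m, by positivity, fun K hK => ⟨fun p hp u hu => ⟨?_, ?_, ?_⟩,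
    fun p hp u hu => ⟨?_, ?_, ?_⟩⟩⟩, fun M _ =>
    ⟨d ^ (l - m) * max 1 M ^ (l - m) * (d ^ m * N), by positivity,
      fun K hK hKM p hp u hu => ⟨?_, ?_, ?_⟩⟩⟩
  · rw [Element.domTilde_eq hK, Element.toTilde_eq hK]
    exact hu.comp_affineHomeo_symm hp (isOpen_domHat K) _ _
  · intro hp'
    have h := sobolevSeminorm_toTilde_le hd0 hK hp hu fun β hβ =>
      le_rpow_sum (multiIndices d m) (fun β => (multiPow K.h β)⁻¹ *
        normLp p K.domHat (weakDeriv K.domHat (stdDir d) β u))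
        (fun β _ => mul_nonneg (inv_nonneg.2 (multiPow_nonneg (fun i => (hK.h_pos i).le) β))
          lpNorm_nonneg) (one_le_toReal hp hp') hβ
    simp only [inv_multiPow_rpow_mul_rpow hK _ lpNorm_nonneg, normLp] at h ⊢
    simpa using h
  · rintro rfl
    have h := sobolevSeminorm_toTilde_le hd0 hK hp hu fun β hβ =>
      le_ciSup (f := fun β : multiIndices d m => (multiPow K.h β)⁻¹ *
        normLp ∞ K.domHat (weakDeriv K.domHat (stdDir d) β u))
        (Set.finite_range _).bddAbove ⟨β, hβ⟩
    simpa using h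
  · rw [Element.domT_eq hK, Element.toT_eq hK]
    exact hu.comp_affineHomeo_symm hp (isOpen_domHat K) _ _
  · intro ε hε
    rw [Element.domT_eq hK, Element.toT_eq hK]
    have h := (hu.comp_affineHomeo_symm hp (isOpen_domHat K) _ _ :
      MemSobolev l p (Element.homeoT hK '' K.domHat) _).weakDeriv (m := m) hp
      ((Element.homeoT hK).isOpenMap _ (isOpen_domHat K)) K.edgeDir (ε := ε) (by
        rw [Finset.Nat.mem_antidiagonalTuple.1 hε]; omega)
    exact ⟨⟨_, hasWeakDeriv_iff.2 h.1⟩, h.2⟩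
  · intro β hβ γ hγ
    have h := normLp_weakDeriv_le_edge
      (A := oprEquiv (K.matT * K.matATilde) hK.isUnit_det_mul) (b := K.vecT)
      (κ := ‖opr K.matTilde‖) hp (isOpen_domHat K) hml hu hK.h_pos (norm_nonneg _)
      (fun i j => by
        change |opr (K.matT * K.matATilde) (stdDir d i) j| ≤ _
        rw [opr_stdDir]
        exact hK.abs_matT_mul_matATilde_le i j)
      (r := K.edgeDir) hK.opr_stdDir_eq_smul_edgeDir hβ hγ
    rw [hjac K hK] at h
    rw [Element.domT_eq hK, Element.toT_eq hK]
    refine h.trans ?_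
    have h0 : ∀ ε ∈ multiIndices d (l - m), 0 ≤ multiPow K.h ε *
        sobolevSeminorm m p (Element.homeoT hK '' K.domHat)
          (weakDeriv (Element.homeoT hK '' K.domHat) K.edgeDir ε
            (u ∘ (Element.homeoT hK).symm)) := fun ε _ =>
      mul_nonneg (multiPow_nonneg (fun i => (hK.h_pos i).le) ε) (sobolevSeminorm_nonneg m)
    -- the single term `ε = γ` of the sum suffices
    have h1 := Finset.single_le_sum h0 hγ
    have hc : d ^ m * N ≤ N ^ 2 * d ^ m := by
      rw [mul_comm, sq]
      exact mul_le_mul_of_nonneg_right (le_mul_of_one_le_left (by linarith) hN) (by positivity)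
    have hβ0 := multiPow_nonneg (fun i => (hK.h_pos i).le) β
    exact mul_le_mul (by gcongr) h1 (h0 γ hγ) (by positivity)
  · rw [Element.domTilde_eq hK, Element.toTilde_eq hK]
    exact hu.comp_affineHomeo_symm hp (isOpen_domHat K) _ _
  · intro ε hε
    rw [Element.domTilde_eq hK, Element.toTilde_eq hK]
    exact ((hu.comp_affineHomeo_symm hp (isOpen_domHat K) _ _ :
      MemSobolev l p (Element.homeoTilde hK '' K.domHat) _).weakDeriv (m := m) hp
      ((Element.homeoTilde hK).isOpenMap _ (isOpen_domHat K)) (stdDir d) (ε := ε) (by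
        rw [Finset.Nat.mem_antidiagonalTuple.1 hε]; omega)).2
  · intro β hβ γ hγ
    have h := normLp_weakDeriv_le_coord
      (A := oprEquiv K.matATilde hK.isUnit_det) (b := 0) (κ := ‖opr K.matTilde‖)
      (M := max 1 M) (H := K.H) hp (isOpen_domHat K) hml hu hK.h_pos (norm_nonneg _)
      (fun i j => by
        change |opr K.matATilde (stdDir d i) j| ≤ _
        rw [opr_stdDir]
        exact hK.abs_matATilde_le i j)
      (zero_le_one.trans (le_max_left _ _)) hK.H_nonneg
      (fun i j => by
        change |opr K.matATilde (stdDir d i) j| ≤ _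
        rw [opr_stdDir]
        exact hK.abs_matATilde_le_H hKM i j) hβ hγ
    rw [jac_oprEquiv] at h
    rw [Element.domTilde_eq hK, Element.toTilde_eq hK]
    exact h
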